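/- Let $Y(\mathfrak{sl}(3))$ be the Yangian of $\mathfrak{sl}(3)=\mathfrak{sl}(3,\mathbb C)$ in Drinfeld's first presentation. Write $(x|y)=\operatorname{tr}(xy)$, let $\{x_\lambda\}$ be an orthonormal basis of $\mathfrak{sl}(3)$ for this form, put $\Omega=\sum_\lambda x_\lambda\otimes x_\lambda$, and let $\{z_1,z_2,z_3\}=\frac1{24}\sum_{\pi\in S_3}z_{\pi(1)}z_{\pi(2)}z_{\pi(3)}$. Then $Y(\mathfrak{sl}(3))$ is the unital associative $\mathbb C$-algebra generated by $x$ and $J(x)$ ($x\in\mathfrak{sl}(3)$), both linear in $x$, subject to $xy-yx=[x,y]$, $[x,J(y)]=J([x,y])$, $$[J(x),J([y,z])]+[J(z),J([x,y])]+[J(y),J([z,x])]=\sum_{\lambda,\mu,\nu}c_{\lambda\mu\nu}(x,y,z)\{x_\lambda,x_\mu,x_\nu\},$$ $$[[J(x),J(y)],[z,J(w)]]+[[J(z),J(w)],[x,J(y)]]=\sum_{\lambda,\mu,\nu}\bigl(c_{\lambda\mu\nu}(x,y,[z,w])+c_{\lambda\mu\nu}(z,w,[x,y])\bigr)\{x_\lambda,x_\mu,J(x_\nu)\},$$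 where $c_{\lambda\mu\nu}(x,y,z)=\bigl([x,x_\lambda]\,\big|\,[[y,x_\mu],[z,x_\nu]]\bigr)$. Its coproduct is given on generators by $\Delta(x)=x\otimes1+1\otimes x$ and $\Delta(J(x))=J(x)\otimes1+1\otimes J(x)+\frac12[x\otimes1,\Omega]$. Let $V(\lambda_1)=\mathbb C^3$ be the vector representation of $\mathfrak{sl}(3)$ and $V(\lambda_2)$ its dual. For $a,b\in\mathbb C$ let $V(\lambda_1,a)$ and $V(\lambda_2,b)$ be the representations of $Y(\mathfrak{sl}(3))$ on these spaces that extend the action of $\mathfrak{sl}(3)$ by $J(x)=a\,x$ and $J(x)=b\,x$ respectively. Let $W=V(\lambda_1,a)\otimes V(\lambda_2,b)$ be their tensor product, on which $Y(\mathfrak{sl}(3))$ acts through $\Delta$. Then these representations are well defined, and the following hold. If $a-b\neq\pm\frac32$, then $W$ is an irreducible representation of $Y(\mathfrak{sl}(3))$. Otherwise $W$ has a unique nonzero proper subrepresentation $U$, and: (1) If $a-b=\frac32$, then $U$ is isomorphic, as a representation of $Y(\mathfrak{sl}(3))$, to the trivial representation $V(0,0)$ (the one-dimensional space on which all $x$ and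 $J(x)$ act as $0$), and $W/U$ is isomorphic, as a representation of $\mathfrak{sl}(3)$, to the 8-dimensional adjoint representation $V(\lambda_1+\lambda_2)$. (2) If $a-b=-\frac32$, then $U$ is isomorphic, as a representation of $\mathfrak{sl}(3)$, to the 8-dimensional adjoint representation $V(\lambda_1+\lambda_2)$. -/

import Mathlib

open scoped TensorProduct

noncomputable section

namespace YangianSL3

/-- The complex Lie algebra of traceless `3 × 3` matrices. -/
abbrev sl3 : Type := LieAlgebra.SpecialLinear.sl (Fin 3) ℂ

/-- The invariant bilinear form `(x | y) = tr (x y)`. -/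
def form (x y : sl3) : ℂ := Matrix.trace (x.1 * y.1)

/-- The projection `X ↦ X - (tr X / 3) • 1` from `gl(3)` onto `sl(3)`. -/
def traceless (X : Matrix (Fin 3) (Fin 3) ℂ) : sl3 :=
  ⟨X - (X.trace / 3) • (1 : Matrix (Fin 3) (Fin 3) ℂ), by
    change Matrix.trace (X - (X.trace / 3) • (1 : Matrix (Fin 3) (Fin 3) ℂ)) = 0
    simp [Matrix.trace_sub, Matrix.trace_smul]⟩

/-- The traceless part of the matrix unit `E_{ij}`, for `p = (i, j)`. The families `e p` and
`e p.swap` are used in place of a pair of dual bases for the trace form: `∑ p, e p ⊗ e p.swap` is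
the canonical (Casimir) tensor `∑ i, b i ⊗ b' i` of any pair of dual bases `b`, `b'`, in particular
`∑ i, x i ⊗ x i` for any orthonormal basis `x`; this is `sum_tmul_eq_of_dual_bases` below. -/
def e (p : Fin 3 × Fin 3) : sl3 := traceless (Matrix.single p.1 p.2 1)

/-- The families `e p` and `e p.swap` reproduce every element of `sl(3)`. -/
theorem sum_form_smul_e (x : sl3) : ∑ p, form (e p.swap) x • e p = x := by
  have hx : Matrix.trace x.1 = 0 := x.2
  have h1 : ∀ p : Fin 3 × Fin 3, form (e p.swap) x = x.1 p.1 p.2 := by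
    rintro ⟨i, j⟩
    simp [form, e, traceless, sub_mul, Matrix.trace_sub, hx, Matrix.trace_single_mul]
  simp only [h1]
  apply Subtype.ext
  rw [AddSubmonoidClass.coe_finsetSum]
  rw [Matrix.trace_fin_three] at hx
  ext i j
  simp only [Fintype.sum_prod_type, Fin.sum_univ_three, Matrix.add_apply]
  fin_cases i <;> fin_cases j <;>
    simp [e, traceless] <;> linear_combination (-(1 : ℂ) / 3) * hx

/-- `∑ p, e p ⊗ e p.swap` is the canonical tensor of the trace form. -/
theorem sum_tmul_eq_of_dual_bases {ι : Type*} [Fintype ι] [DecidableEq ι]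
    (b b' : Module.Basis ι ℂ sl3) (h : ∀ i j, form (b i) (b' j) = if i = j then 1 else 0) :
    ∑ i, b i ⊗ₜ[ℂ] b' i = ∑ p, e p ⊗ₜ[ℂ] e p.swap := by
  have hb : ∀ x : sl3, x = ∑ i, form x (b i) • b' i := by
    intro x
    have hx : ∀ i, form x (b i) = b'.repr x i := by
      intro i
      have h2 : form x (b i) = form (b i) x := Matrix.trace_mul_comm _ _
      let L : sl3 →ₗ[ℂ] ℂ :=
        { toFun := form (b i)
          map_add' := fun u v => by simp [form, mul_add, Matrix.trace_add]
          map_smul' := fun c v => by simp [form] }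
      have h3 : form (b i) x = L (∑ j, b'.repr x j • b' j) := by
        rw [b'.sum_repr]; rfl
      rw [h2, h3, map_sum]
      have h4 : ∀ j, L (b' j) = if i = j then 1 else 0 := h i
      simp [h4]
    simp only [hx]
    exact (b'.sum_repr x).symm
  calc ∑ i, b i ⊗ₜ[ℂ] b' i
      = ∑ i, (∑ p, form (e p.swap) (b i) • e p) ⊗ₜ[ℂ] b' i := by
        simp only [sum_form_smul_e]
    _ = ∑ p, e p ⊗ₜ[ℂ] (∑ i, form (e p.swap) (b i) • b' i) := by
        simp only [TensorProduct.sum_tmul, TensorProduct.tmul_sum, TensorProduct.smul_tmul]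
        exact Finset.sum_comm
    _ = ∑ p, e p ⊗ₜ[ℂ] e p.swap := by
        simp only [← hb]

/-- The commutator in an associative algebra. -/
def comm {A : Type*} [Ring A] (u v : A) : A := u * v - v * u

/-- The symmetrized product `{u, v, w} = (1 / 24) ∑ π, z_{π 1} z_{π 2} z_{π 3}`. -/
def sym3 {A : Type*} [Ring A] [Algebra ℂ A] (u v w : A) : A :=
  (1 / 24 : ℂ) • (u * v * w + u * w * v + v * u * w + v * w * u + w * u * v + w * v * u)

/-- The generating symbols `x` and `J(x)`, for `x` in `sl(3)`. -/
inductive Gen : Type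
  | I (x : sl3) : Gen
  | J (x : sl3) : Gen

/-- The free associative algebra on the generating symbols. -/
abbrev Free : Type := FreeAlgebra ℂ Gen

/-- The symbol `x` in the free algebra. -/
def fI (x : sl3) : Free := FreeAlgebra.ι ℂ (Gen.I x)

/-- The symbol `J(x)` in the free algebra. -/
def fJ (x : sl3) : Free := FreeAlgebra.ι ℂ (Gen.J x)

/-- The structure coefficients `([x, e_p], [[y, e_q], [z, e_r]])`. -/
def coeff (x y z : sl3) (p q r : Fin 3 × Fin 3) : ℂ :=
  form ⁅x, e p⁆ ⁅⁅y, e q⁆, ⁅z, e r⁆⁆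

/-- The defining relations of the Yangian of `sl(3)` in Drinfeld's first presentation. Both sides
of `quartic` are invariant under the exchange of `(x, y)` and `(z, w)`. -/
inductive Rel : Free → Free → Prop
  | I_add (x y : sl3) : Rel (fI (x + y)) (fI x + fI y)
  | I_smul (c : ℂ) (x : sl3) : Rel (fI (c • x)) (c • fI x)
  | I_lie (x y : sl3) : Rel (comm (fI x) (fI y)) (fI ⁅x, y⁆)
  | J_add (x y : sl3) : Rel (fJ (x + y)) (fJ x + fJ y)
  | J_smul (c : ℂ) (x : sl3) : Rel (fJ (c • x)) (c • fJ x)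
  | I_J (x y : sl3) : Rel (comm (fI x) (fJ y)) (fJ ⁅x, y⁆)
  | cubic (x y z : sl3) :
      Rel (comm (fJ x) (fJ ⁅y, z⁆) + comm (fJ z) (fJ ⁅x, y⁆) + comm (fJ y) (fJ ⁅z, x⁆))
        (∑ p, ∑ q, ∑ r, coeff x y z p q r • sym3 (fI (e p.swap)) (fI (e q.swap)) (fI (e r.swap)))
  | quartic (x y z w : sl3) :
      Rel (comm (comm (fJ x) (fJ y)) (comm (fI z) (fJ w)) +
          comm (comm (fJ z) (fJ w)) (comm (fI x) (fJ y)))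
        (∑ p, ∑ q, ∑ r, (coeff x y ⁅z, w⁆ p q r + coeff z w ⁅x, y⁆ p q r) •
          sym3 (fI (e p.swap)) (fI (e q.swap)) (fJ (e r.swap)))

/-- The Yangian `Y(sl(3))`. -/
abbrev Yangian : Type := RingQuot Rel

/-- The quotient map from the free algebra. -/
def mk : Free →ₐ[ℂ] Yangian := RingQuot.mkAlgHom ℂ Rel

/-- The generator `x` of the Yangian. -/
def I (x : sl3) : Yangian := mk (fI x)

/-- The generator `J(x)` of the Yangian. -/
def J (x : sl3) : Yangian := mk (fJ x)

/-- A representation of the Yangian is determined by the action of the generators. -/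
theorem hom_ext {A : Type*} [Ring A] [Algebra ℂ A] {f g : Yangian →ₐ[ℂ] A}
    (hI : ∀ x, f (I x) = g (I x)) (hJ : ∀ x, f (J x) = g (J x)) : f = g := by
  apply RingQuot.ringQuot_ext'
  apply FreeAlgebra.hom_ext
  funext s
  cases s with
  | I x => exact hI x
  | J x => exact hJ x

/-- Drinfeld's coproduct, on words in the generators:
`Δ(x) = x ⊗ 1 + 1 ⊗ x` and `Δ(J(x)) = J(x) ⊗ 1 + 1 ⊗ J(x) + (1 / 2) [x ⊗ 1, Ω]`,
where `Ω` is the canonical tensor of the trace form. -/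
def coproduct : Free →ₐ[ℂ] Yangian ⊗[ℂ] Yangian :=
  FreeAlgebra.lift ℂ fun s : Gen =>
    match s with
    | Gen.I x => I x ⊗ₜ 1 + 1 ⊗ₜ I x
    | Gen.J x => J x ⊗ₜ 1 + 1 ⊗ₜ J x +
        (1 / 2 : ℂ) • comm (I x ⊗ₜ[ℂ] (1 : Yangian)) (∑ p, I (e p) ⊗ₜ[ℂ] I (e p.swap))

section Representations

variable {M N : Type*} [AddCommGroup M] [Module ℂ M] [AddCommGroup N] [Module ℂ N]

/-- `ρ` is the representation in which `sl(3)` acts through `σ` and `J(x) = a x`. -/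
def IsEvaluation (σ : sl3 → Module.End ℂ M) (a : ℂ) (ρ : Yangian →ₐ[ℂ] Module.End ℂ M) : Prop :=
  ∀ x, ρ (I x) = σ x ∧ ρ (J x) = a • σ x

/-- `ρ` is the tensor product of `ρ₁` and `ρ₂`: every word in the generators acts on `M ⊗ N`
through its coproduct. -/
def IsTensorProduct (ρ₁ : Yangian →ₐ[ℂ] Module.End ℂ M) (ρ₂ : Yangian →ₐ[ℂ] Module.End ℂ N)
    (ρ : Yangian →ₐ[ℂ] Module.End ℂ (M ⊗[ℂ] N)) : Prop :=
  ∀ f : Free, ρ (mk f) =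
    Module.endTensorEndAlgHom (R := ℂ) (S := ℂ) (A := ℂ)
      (Algebra.TensorProduct.map ρ₁ ρ₂ (coproduct f))

/-- `U` is a subrepresentation of `ρ`. -/
def IsSubrep (ρ : Yangian →ₐ[ℂ] Module.End ℂ M) (U : Submodule ℂ M) : Prop :=
  ∀ y, ∀ u ∈ U, ρ y u ∈ U

/-- `U` is a nonzero subrepresentation of `ρ` other than the whole space. -/
def IsProperSubrep (ρ : Yangian →ₐ[ℂ] Module.End ℂ M) (U : Submodule ℂ M) : Prop :=
  IsSubrep ρ U ∧ U ≠ ⊥ ∧ U ≠ ⊤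

/-- `ρ` is irreducible. -/
def IsIrreducible (ρ : Yangian →ₐ[ℂ] Module.End ℂ M) : Prop :=
  Nontrivial M ∧ ∀ U : Submodule ℂ M, IsSubrep ρ U → U = ⊥ ∨ U = ⊤

end Representations

/-- The vector representation `V(λ₁)` of `sl(3)`. -/
abbrev V : Type := Fin 3 → ℂ

/-- The dual space of `V(λ₁)`, which carries `V(λ₂)`. -/
abbrev VDual : Type := Module.Dual ℂ V

/-- The action of `sl(3)` on `V(λ₁)`. -/
def vecAction (x : sl3) : Module.End ℂ V := Matrix.toLin' x.1

/-- The action of `sl(3)` on the dual: `(x φ)(v) = - φ (x v)`. -/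
def dualAction (x : sl3) : Module.End ℂ VDual := -(vecAction x).dualMap

end YangianSL3

end

noncomputable section

namespace YangianSL3

open Matrix

/-! Identify `V ⊗ V*` with the `3 × 3` matrices. Then `x` acts by `X ↦ xX - Xx`. Since the canonical
tensor acts by `X ↦ X/3 - tr(X) 1`, Drinfeld's coproduct makes `J(x)` act by `X ↦ a xX - b Xx +
(tr(xX) 1 - tr(X) x)/2`.

Under `sl(3)` the matrices split into two inequivalent irreducible pieces, the scalars and the
traceless matrices, so only four subspaces are stable (`adjoint_stable_classification`). It remains
to see which of them `J` preserves. On the identity, `J(x)` gives `(a - b - 3/2) x`, so the scalars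
are stable exactly when `a - b = 3/2`. On a traceless `X`, the trace of `J(x) X` is `(a - b + 3/2)
tr(xX)`, so the traceless matrices are stable exactly when `a - b = -3/2`.

Most of the work goes into well-definedness, that is, the cubic and quartic relations. Invariance of
the form turns their right-hand sides into sums of `{e_p', e_q', [[[x, e_p], [y, e_q]], z]}`, where
`e_p'` is dual to `e_p`. On `V` and `V*` these sums vanish, and the left-hand sides vanish by the
Jacobi identity and antisymmetry. On matrices, `[J(x), J(y)] = (a + b) J([x, y]) - ab [x, y] + (3/4)
pair(x, y)` (`comm_tensJ_tensJ`), and the right-hand sides are given in closed form by `opSum_adOp`,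
`opSum_acOp` and `opSum_trOp`. The relations are checked directly on these operators, so the
coproduct need not be shown to descend to the Yangian: agreement with it on generators is enough. -/

/-- The complex `3 × 3` matrices. -/
abbrev Mat : Type := Matrix (Fin 3) (Fin 3) ℂ

/-! ### Contractions with the canonical tensor -/

/-- The commutator of a matrix with the matrix of `e p`. -/
def adE (x : Mat) (p : Fin 3 × Fin 3) : Mat := x * (e p).1 - (e p).1 * x

/-- Scalar parts of the `e p` drop out: `[x, ·]` kills those on the right, and those on the left
contribute a multiple of `[x, 1] = 0`. Matrix units then give the formula, as in the contractions
that follow. -/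
theorem sum_e_mul_adE (x N : Mat) :
    ∑ p : Fin 3 × Fin 3, (e p.swap).1 * N * adE x p = (N * x).trace • (1 : Mat) - N.trace • x := by
  ext i j
  simp only [Fintype.sum_prod_type, Fin.sum_univ_three, Matrix.add_apply]
  fin_cases i <;> fin_cases j <;>
    simp [e, traceless, adE, Matrix.mul_apply, Fin.sum_univ_three, Matrix.trace_fin_three,
      Matrix.single_apply, Matrix.one_apply] <;> ring

theorem sum_adE_mul_e (x N : Mat) :
    ∑ p : Fin 3 × Fin 3, adE x p * N * (e p.swap).1 = N.trace • x - (x * N).trace • (1 : Mat) := by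
  ext i j
  simp only [Fintype.sum_prod_type, Fin.sum_univ_three, Matrix.add_apply]
  fin_cases i <;> fin_cases j <;>
    simp [e, traceless, adE, Matrix.mul_apply, Fin.sum_univ_three, Matrix.trace_fin_three,
      Matrix.single_apply, Matrix.one_apply] <;> ring

theorem sum_trace_smul_adE (x N : Mat) :
    ∑ p : Fin 3 × Fin 3, ((e p.swap).1 * N).trace • adE x p = x * N - N * x := by
  ext i j
  simp only [Fintype.sum_prod_type, Fin.sum_univ_three, Matrix.add_apply]
  fin_cases i <;> fin_cases j <;>
    simp [e, traceless, adE, Matrix.mul_apply, Fin.sum_univ_three, Matrix.trace_fin_three,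
      Matrix.single_apply, Matrix.one_apply] <;> ring

theorem sum_form_e_smul (x : sl3) : ∑ p : Fin 3 × Fin 3, form (e p) x • e p.swap = x := by
  refine Eq.trans ?_ (sum_form_smul_e x)
  exact Fintype.sum_equiv (Equiv.prodComm _ _) _ _ fun p => by simp

theorem sum_trace_smul_e (x N : Mat) :
    ∑ p : Fin 3 × Fin 3, (adE x p * N).trace • (e p.swap).1 = N * x - x * N := by
  have hc : Matrix.trace (N * x - x * N) = 0 := by rw [trace_sub, trace_mul_comm, sub_self]
  have h := congrArg Subtype.val (sum_form_e_smul ⟨N * x - x * N, hc⟩)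
  rw [AddSubmonoidClass.coe_finsetSum] at h
  refine Eq.trans ?_ h
  refine Finset.sum_congr rfl fun p _ => ?_
  have ht : (adE x p * N).trace = form (e p) ⟨N * x - x * N, hc⟩ := by
    simp only [form, adE, sub_mul, mul_sub, trace_sub]
    rw [mul_assoc, trace_mul_comm, mul_assoc, mul_assoc]
  rw [ht]
  rfl

/-- The commutator of `adE x p` and `adE y q`. -/
def commE (x y : Mat) (p q : Fin 3 × Fin 3) : Mat := adE x p * adE y q - adE y q * adE x p

/-- Double contractions reduce to two single ones: for fixed `q`, each term of the commutator
contains `p` once in `e p.swap` and once in `adE x p`. The free matrices `M` and `N` later absorb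
the outer factor `z` and the argument `X`. -/
theorem sum_e_e_commE (x y M N : Mat) :
    ∑ q : Fin 3 × Fin 3, ∑ p : Fin 3 × Fin 3,
      (e p.swap).1 * M * (e q.swap).1 * N * commE x y p q =
    y * (N * x * M) - N * x * M * y - x * (y * (N * M) - N * M * y)
      - ((M * x).trace * (N * y).trace - N.trace * (M * y * x).trace) • (1 : Mat)
      + (M.trace * (N * y).trace - N.trace * (M * y).trace) • x := by
  have inner : ∀ q : Fin 3 × Fin 3, ∑ p : Fin 3 × Fin 3,
      (e p.swap).1 * M * (e q.swap).1 * N * commE x y p q =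
      ((e q.swap).1 * (N * x * M)).trace • adE y q
        - x * ((e q.swap).1 * (N * M)).trace • adE y q
        - (M * ((e q.swap).1 * N * adE y q) * x).trace • (1 : Mat)
        + (M * ((e q.swap).1 * N * adE y q)).trace • x := by
    intro q
    have h1 := sum_e_mul_adE x (M * (e q.swap).1 * N)
    have h2 := sum_e_mul_adE x (M * (e q.swap).1 * N * adE y q)
    have h3 : ∀ p : Fin 3 × Fin 3, (e p.swap).1 * M * (e q.swap).1 * N * commE x y p q =
        (e p.swap).1 * (M * (e q.swap).1 * N) * adE x p * adE y q -
        (e p.swap).1 * (M * (e q.swap).1 * N * adE y q) * adE x p := by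
      intro p; simp only [commE]; noncomm_ring
    simp only [h3, Finset.sum_sub_distrib, ← Finset.sum_mul, h1, h2]
    -- Cyclicity moves `e q.swap` to the front of the trace, the form required by
    -- `sum_trace_smul_adE` for the sum over `q`.
    have t1 : (M * (e q.swap).1 * N * x).trace = ((e q.swap).1 * (N * x * M)).trace := by
      rw [mul_assoc, mul_assoc, trace_mul_comm]; simp only [mul_assoc]
    have t2 : (M * (e q.swap).1 * N).trace = ((e q.swap).1 * (N * M)).trace := by
      rw [mul_assoc, trace_mul_comm]; simp only [mul_assoc]
    rw [t1, t2]
    simp only [sub_mul, smul_mul_assoc, one_mul, mul_smul_comm, mul_assoc]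
    abel
  simp only [inner, Finset.sum_add_distrib, Finset.sum_sub_distrib, ← Finset.mul_sum,
    ← Finset.sum_smul, ← Matrix.trace_sum, ← Finset.sum_mul, sum_trace_smul_adE, sum_e_mul_adE]
  simp only [mul_sub, sub_mul, mul_smul_comm, smul_mul_assoc, mul_one, trace_sub, trace_smul,
    smul_eq_mul]
  module

theorem sum_commE_e_e (x y M N : Mat) :
    ∑ q : Fin 3 × Fin 3, ∑ p : Fin 3 × Fin 3,
      commE x y p q * M * (e p.swap).1 * N * (e q.swap).1 =
    (x * (N * M) - N * M * x) * y - (x * (N * y * M) - N * y * M * x)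
      - (M.trace * (x * N).trace - (x * M).trace * N.trace) • y
      + (M.trace * (y * x * N).trace - (x * M).trace * (y * N).trace) • (1 : Mat) := by
  have inner : ∀ p : Fin 3 × Fin 3, ∑ q : Fin 3 × Fin 3,
      commE x y p q * M * (e p.swap).1 * N * (e q.swap).1 =
      ((e p.swap).1 * (N * M)).trace • adE x p * y
        - ((e p.swap).1 * (N * y * M)).trace • adE x p
        - (adE x p * M * (e p.swap).1 * N).trace • y
        + (y * (adE x p * M * (e p.swap).1) * N).trace • (1 : Mat) := by
    intro p
    have h1 := sum_adE_mul_e y (M * (e p.swap).1 * N)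
    have h2 := sum_adE_mul_e y (adE x p * M * (e p.swap).1 * N)
    have h3 : ∀ q : Fin 3 × Fin 3, commE x y p q * M * (e p.swap).1 * N * (e q.swap).1 =
        adE x p * (adE y q * (M * (e p.swap).1 * N) * (e q.swap).1) -
        adE y q * (adE x p * M * (e p.swap).1 * N) * (e q.swap).1 := by
      intro q; simp only [commE]; noncomm_ring
    simp only [h3, Finset.sum_sub_distrib, ← Finset.mul_sum, h1, h2]
    have t1 : (y * (M * (e p.swap).1 * N)).trace = ((e p.swap).1 * (N * y * M)).trace := by
      rw [← mul_assoc, ← mul_assoc, mul_assoc, trace_mul_comm, mul_assoc, mul_assoc]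
    have t2 : (M * (e p.swap).1 * N).trace = ((e p.swap).1 * (N * M)).trace := by
      rw [mul_assoc, trace_mul_comm]; simp only [mul_assoc]
    rw [t1, t2]
    simp only [mul_sub, smul_mul_assoc, mul_one, mul_smul_comm, mul_assoc]
    abel
  rw [Finset.sum_comm]
  simp only [inner, Finset.sum_add_distrib, Finset.sum_sub_distrib, ← Finset.mul_sum,
    ← Finset.sum_smul, ← Matrix.trace_sum, ← Finset.sum_mul, sum_trace_smul_adE, sum_adE_mul_e]
  simp only [mul_sub, sub_mul, mul_smul_comm, smul_mul_assoc, mul_one, trace_sub, trace_smul,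
    smul_eq_mul, one_mul]

theorem sum_e_commE_e (x y M N : Mat) :
    ∑ q : Fin 3 × Fin 3, ∑ p : Fin 3 × Fin 3,
      (e p.swap).1 * M * commE x y p q * N * (e q.swap).1 =
    ((M * x).trace • (1 : Mat) - M.trace • x) * (N.trace • y - (y * N).trace • (1 : Mat))
      - N * (x * M * y - y * (x * M)) + x * N * (M * y - y * M) := by
  have inner : ∀ q : Fin 3 × Fin 3, ∑ p : Fin 3 × Fin 3,
      (e p.swap).1 * M * commE x y p q * N * (e q.swap).1 =
      ((M * x).trace • (1 : Mat) - M.trace • x) * (adE y q * N * (e q.swap).1)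
        - N * (adE y q * (x * M)).trace • (e q.swap).1
        + x * N * (adE y q * M).trace • (e q.swap).1 := by
    intro q
    have h1 := sum_e_mul_adE x M
    have h2 := sum_e_mul_adE x (M * adE y q)
    have h3 : ∀ p : Fin 3 × Fin 3, (e p.swap).1 * M * commE x y p q * N * (e q.swap).1 =
        (e p.swap).1 * M * adE x p * (adE y q * N * (e q.swap).1) -
        (e p.swap).1 * (M * adE y q) * adE x p * (N * (e q.swap).1) := by
      intro p; simp only [commE]; noncomm_ring
    simp only [h3, Finset.sum_sub_distrib, ← Finset.sum_mul, h1, h2]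
    have t1 : (M * adE y q * x).trace = (adE y q * (x * M)).trace := by
      rw [mul_assoc, trace_mul_comm, mul_assoc]
    have t2 : (M * adE y q).trace = (adE y q * M).trace := trace_mul_comm _ _
    rw [t1, t2]
    simp only [sub_mul, smul_mul_assoc, one_mul, mul_smul_comm, mul_assoc]
    abel
  simp only [inner, Finset.sum_add_distrib, Finset.sum_sub_distrib, ← Finset.mul_sum,
    sum_trace_smul_e, sum_adE_mul_e]

/-- The commutator of `commE x y p q` with `z`. -/
def tripleE (x y z : Mat) (p q : Fin 3 × Fin 3) : Mat := commE x y p q * z - z * commE x y p q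

/-- With this symmetry, three of the six orders of the letters in a symmetrized product determine
the other three. -/
theorem commE_swap (x y : Mat) (p q : Fin 3 × Fin 3) : commE x y q p = -commE y x p q := by
  simp [commE]

theorem tripleE_swap (x y z : Mat) (p q : Fin 3 × Fin 3) :
    tripleE x y z q p = -tripleE y x z p q := by
  simp only [tripleE, commE_swap x y p q]
  noncomm_ring

/-- The contraction of `u * M * v * N * [a, b]`. -/
def contrLeft (x y M N : Mat) : Mat :=
    y * (N * x * M) - N * x * M * y - x * (y * (N * M) - N * M * y)
      - ((M * x).trace * (N * y).trace - N.trace * (M * y * x).trace) • (1 : Mat)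
      + (M.trace * (N * y).trace - N.trace * (M * y).trace) • x

/-- The contraction of `[a, b] * M * u * N * v`. -/
def contrRight (x y M N : Mat) : Mat :=
    (x * (N * M) - N * M * x) * y - (x * (N * y * M) - N * y * M * x)
      - (M.trace * (x * N).trace - (x * M).trace * N.trace) • y
      + (M.trace * (y * x * N).trace - (x * M).trace * (y * N).trace) • (1 : Mat)

/-- The contraction of `u * M * [a, b] * N * v`. -/
def contrMid (x y M N : Mat) : Mat :=
    ((M * x).trace • (1 : Mat) - M.trace • x) * (N.trace • y - (y * N).trace • (1 : Mat))
      - N * (x * M * y - y * (x * M)) + x * N * (M * y - y * M)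

theorem sum_e_e_tripleE (x y z M N : Mat) :
    ∑ q : Fin 3 × Fin 3, ∑ p : Fin 3 × Fin 3,
      (e p.swap).1 * M * (e q.swap).1 * N * tripleE x y z p q =
    contrLeft x y M N * z - contrLeft x y M (N * z) := by
  rw [contrLeft, contrLeft, ← sum_e_e_commE, ← sum_e_e_commE, Finset.sum_mul,
    ← Finset.sum_sub_distrib]
  simp only [Finset.sum_mul, ← Finset.sum_sub_distrib, tripleE, mul_sub, mul_assoc]

theorem sum_tripleE_e_e (x y z M N : Mat) :
    ∑ q : Fin 3 × Fin 3, ∑ p : Fin 3 × Fin 3,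
      tripleE x y z p q * M * (e p.swap).1 * N * (e q.swap).1 =
    contrRight x y (z * M) N - z * contrRight x y M N := by
  rw [contrRight, contrRight, ← sum_commE_e_e, ← sum_commE_e_e, Finset.mul_sum,
    ← Finset.sum_sub_distrib]
  simp only [Finset.mul_sum, ← Finset.sum_sub_distrib, tripleE, sub_mul, mul_assoc]

theorem sum_e_tripleE_e (x y z M N : Mat) :
    ∑ q : Fin 3 × Fin 3, ∑ p : Fin 3 × Fin 3,
      (e p.swap).1 * M * tripleE x y z p q * N * (e q.swap).1 =
    contrMid x y M (z * N) - contrMid x y (M * z) N := by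
  rw [contrMid, contrMid, ← sum_e_commE_e, ← sum_e_commE_e, ← Finset.sum_sub_distrib]
  simp only [← Finset.sum_sub_distrib, tripleE, sub_mul, mul_sub, mul_assoc]

theorem sum_e_e_tripleE' (x y z M N : Mat) :
    ∑ q : Fin 3 × Fin 3, ∑ p : Fin 3 × Fin 3,
      (e q.swap).1 * M * (e p.swap).1 * N * tripleE x y z p q =
    -(contrLeft y x M N * z - contrLeft y x M (N * z)) := by
  rw [← sum_e_e_tripleE, Finset.sum_comm]
  simp only [tripleE_swap x y z, mul_neg, Finset.sum_neg_distrib]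

theorem sum_tripleE_e_e' (x y z M N : Mat) :
    ∑ q : Fin 3 × Fin 3, ∑ p : Fin 3 × Fin 3,
      tripleE x y z p q * M * (e q.swap).1 * N * (e p.swap).1 =
    -(contrRight y x (z * M) N - z * contrRight y x M N) := by
  rw [← sum_tripleE_e_e, Finset.sum_comm]
  simp only [tripleE_swap x y z, neg_mul, Finset.sum_neg_distrib]

theorem sum_e_tripleE_e' (x y z M N : Mat) :
    ∑ q : Fin 3 × Fin 3, ∑ p : Fin 3 × Fin 3,
      (e q.swap).1 * M * tripleE x y z p q * N * (e p.swap).1 =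
    -(contrMid y x M (z * N) - contrMid y x (M * z) N) := by
  rw [← sum_e_tripleE_e, Finset.sum_comm]
  simp only [tripleE_swap x y z, mul_neg, neg_mul, Finset.sum_neg_distrib]

/-! ### Closed forms of the symmetrized contractions -/

section ClosedForms

variable {x y z : Mat}

/-- This vanishing is what allows `J` to act as a scalar multiple of `x` on `V` and on its dual. -/
theorem sum_sym_word (hx : x.trace = 0) (hy : y.trace = 0) (hz : z.trace = 0) :
    ∑ q : Fin 3 × Fin 3, ∑ p : Fin 3 × Fin 3,
      ((e p.swap).1 * (e q.swap).1 * tripleE x y z p q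
       + (e q.swap).1 * (e p.swap).1 * tripleE x y z p q
       + (e p.swap).1 * tripleE x y z p q * (e q.swap).1
       + (e q.swap).1 * tripleE x y z p q * (e p.swap).1
       + tripleE x y z p q * (e p.swap).1 * (e q.swap).1
       + tripleE x y z p q * (e q.swap).1 * (e p.swap).1) =
      0 := by
  have h1 := sum_e_e_tripleE x y z 1 1
  have h2 := sum_e_e_tripleE' x y z 1 1
  have h3 := sum_e_tripleE_e x y z 1 1
  have h4 := sum_e_tripleE_e' x y z 1 1
  have h5 := sum_tripleE_e_e x y z 1 1
  have h6 := sum_tripleE_e_e' x y z 1 1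
  simp only [mul_one] at h1 h2 h3 h4 h5 h6
  simp only [Finset.sum_add_distrib, h1, h2, h3, h4, h5, h6, contrLeft, contrRight, contrMid]
  have s1 : (z * x).trace = (x * z).trace := trace_mul_comm _ _
  have s2 : (z * y).trace = (y * z).trace := trace_mul_comm _ _
  have s3 : (y * x).trace = (x * y).trace := trace_mul_comm _ _
  simp only [mul_add, add_mul, mul_sub, sub_mul, mul_one, one_mul, mul_assoc, mul_smul_comm,
    smul_mul_assoc, trace_one, hx, hy, hz, s1, s2, s3, Fintype.card_fin]
  push_cast
  module

/-- The summand is `[u, [v, w]] + [v, [u, w]]`, the combination through which `trOp w` enters its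
symmetrized product with `adOp u` and `adOp v`. -/
theorem sum_commutator_word (hx : x.trace = 0) (hy : y.trace = 0) (hz : z.trace = 0) :
    ∑ q : Fin 3 × Fin 3, ∑ p : Fin 3 × Fin 3,
      ((e p.swap).1 * (e q.swap).1 * tripleE x y z p q
       - (e p.swap).1 * tripleE x y z p q * (e q.swap).1
       - (e q.swap).1 * tripleE x y z p q * (e p.swap).1
       + tripleE x y z p q * (e q.swap).1 * (e p.swap).1
       + (e q.swap).1 * (e p.swap).1 * tripleE x y z p q
       - (e q.swap).1 * tripleE x y z p q * (e p.swap).1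
       - (e p.swap).1 * tripleE x y z p q * (e q.swap).1
       + tripleE x y z p q * (e p.swap).1 * (e q.swap).1) =
      (18 * (x * z).trace) • y - (18 * (y * z).trace) • x
        - (6 : ℂ) • ((x * y - y * x) * z - z * (x * y - y * x)) := by
  have h1 := sum_e_e_tripleE x y z 1 1
  have h2 := sum_e_tripleE_e x y z 1 1
  have h3 := sum_e_tripleE_e' x y z 1 1
  have h4 := sum_tripleE_e_e' x y z 1 1
  have h5 := sum_e_e_tripleE' x y z 1 1
  have h6 := sum_tripleE_e_e x y z 1 1
  simp only [mul_one] at h1 h2 h3 h4 h5 h6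
  simp only [Finset.sum_add_distrib, Finset.sum_sub_distrib, h1, h2, h3, h4, h5, h6, contrLeft,
    contrRight, contrMid]
  have s1 : (z * x).trace = (x * z).trace := trace_mul_comm _ _
  have s2 : (z * y).trace = (y * z).trace := trace_mul_comm _ _
  have s3 : (y * x).trace = (x * y).trace := trace_mul_comm _ _
  simp only [mul_add, add_mul, mul_sub, sub_mul, mul_one, one_mul, mul_assoc, mul_smul_comm,
    smul_mul_assoc, trace_one, hx, hy, hz, s1, s2, s3, Fintype.card_fin]
  push_cast
  module

/-- This and the next three lemmas treat the words with letters on both sides of `X`, grouped by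
which letters stand on the left and whether `w = tripleE` is among them. -/
theorem sum_e_e_X_tripleE (z : Mat) (hx : x.trace = 0) (hy : y.trace = 0) (X : Mat) :
    ∑ q : Fin 3 × Fin 3, ∑ p : Fin 3 × Fin 3,
      ((e p.swap).1 * (e q.swap).1 * X * tripleE x y z p q
       + (e q.swap).1 * (e p.swap).1 * X * tripleE x y z p q) =
      X * (y * x - x * y) * z + X * z * (x * y - y * x)
        - (3 * (X * x).trace) • (y * z) + (3 * (X * y).trace) • (x * z)
        + (3 * (X * (z * x)).trace) • y - (3 * (X * (z * y)).trace) • x := by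
  have h1 := sum_e_e_tripleE x y z 1 X
  have h2 := sum_e_e_tripleE' x y z 1 X
  simp only [mul_one] at h1 h2
  simp only [Finset.sum_add_distrib, h1, h2, contrLeft]
  have s3 : (y * x).trace = (x * y).trace := trace_mul_comm _ _
  simp only [add_mul, mul_sub, sub_mul, mul_one, one_mul, mul_assoc,
    smul_mul_assoc, trace_one, hx, hy, s3, Fintype.card_fin]
  push_cast
  module

theorem sum_e_tripleE_X_e (hx : x.trace = 0) (hy : y.trace = 0) (hz : z.trace = 0) (X : Mat) :
    ∑ q : Fin 3 × Fin 3, ∑ p : Fin 3 × Fin 3,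
      ((e q.swap).1 * tripleE x y z p q * X * (e p.swap).1
       + tripleE x y z p q * (e q.swap).1 * X * (e p.swap).1
       + (e p.swap).1 * tripleE x y z p q * X * (e q.swap).1
       + tripleE x y z p q * (e p.swap).1 * X * (e q.swap).1) =
      X * (x * y - y * x) * z - X * z * (x * y - y * x)
        + (3 * (X * x).trace) • (z * y) - (3 * (X * y).trace) • (z * x)
        - (3 * (X * z).trace) • (x * y - y * x) + (3 * ((X * (x * y)).trace
          - (X * (y * x)).trace)) • z
        - (3 * (X * (x * z)).trace) • y + (3 * (X * (y * z)).trace) • x := by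
  have h1 := sum_e_tripleE_e' x y z 1 X
  have h2 := sum_tripleE_e_e' x y z 1 X
  have h3 := sum_e_tripleE_e x y z 1 X
  have h4 := sum_tripleE_e_e x y z 1 X
  simp only [mul_one] at h1 h2 h3 h4
  simp only [Finset.sum_add_distrib, h1, h2, h3, h4, contrRight, contrMid]
  have r1 : ∀ A : Mat, (A * X).trace = (X * A).trace := fun A => trace_mul_comm _ _
  have r3 : ∀ A B : Mat, (A * (B * X)).trace = (X * (A * B)).trace := fun A B => by
    rw [← mul_assoc, trace_mul_comm]
  have s1 : (z * x).trace = (x * z).trace := trace_mul_comm _ _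
  have s2 : (z * y).trace = (y * z).trace := trace_mul_comm _ _
  simp only [mul_add, mul_sub, sub_mul, mul_one, one_mul, mul_assoc, mul_smul_comm,
    smul_mul_assoc, trace_one, hx, hy, hz, s1, s2, r1, r3, Fintype.card_fin]
  push_cast
  module

theorem sum_tripleE_X_e_e (z : Mat) (hx : x.trace = 0) (hy : y.trace = 0) (X : Mat) :
    ∑ q : Fin 3 × Fin 3, ∑ p : Fin 3 × Fin 3,
      (tripleE x y z p q * X * (e p.swap).1 * (e q.swap).1
       + tripleE x y z p q * X * (e q.swap).1 * (e p.swap).1) =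
      (y * x - x * y) * z * X + z * (x * y - y * x) * X
        - (3 * (X * x).trace) • (z * y) + (3 * (X * y).trace) • (z * x)
        + (3 * (X * (x * z)).trace) • y - (3 * (X * (y * z)).trace) • x := by
  have h1 := sum_tripleE_e_e x y z X 1
  have h2 := sum_tripleE_e_e' x y z X 1
  simp only [mul_one] at h1 h2
  simp only [Finset.sum_add_distrib, h1, h2, contrRight]
  have r1 : ∀ A : Mat, (A * X).trace = (X * A).trace := fun A => trace_mul_comm _ _
  have r3 : ∀ A B : Mat, (A * (B * X)).trace = (X * (A * B)).trace := fun A B => by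
    rw [← mul_assoc, trace_mul_comm]
  have s3 : (y * x).trace = (x * y).trace := trace_mul_comm _ _
  simp only [mul_add, mul_sub, sub_mul, mul_one, one_mul, mul_assoc, mul_smul_comm,
    trace_one, hx, hy, s3, r1, r3, Fintype.card_fin]
  push_cast
  module

theorem sum_e_X_e_tripleE (hx : x.trace = 0) (hy : y.trace = 0) (hz : z.trace = 0) (X : Mat) :
    ∑ q : Fin 3 × Fin 3, ∑ p : Fin 3 × Fin 3,
      ((e p.swap).1 * X * (e q.swap).1 * tripleE x y z p q
       + (e p.swap).1 * X * tripleE x y z p q * (e q.swap).1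
       + (e q.swap).1 * X * (e p.swap).1 * tripleE x y z p q
       + (e q.swap).1 * X * tripleE x y z p q * (e p.swap).1) =
      (x * y - y * x) * z * X - z * (x * y - y * x) * X
        + (3 * (X * x).trace) • (y * z) - (3 * (X * y).trace) • (x * z)
        + (3 * (X * z).trace) • (x * y - y * x) - (3 * ((X * (x * y)).trace
          - (X * (y * x)).trace)) • z
        - (3 * (X * (z * x)).trace) • y + (3 * (X * (z * y)).trace) • x := by
  have h1 := sum_e_e_tripleE x y z X 1
  have h2 := sum_e_tripleE_e x y z X 1
  have h3 := sum_e_e_tripleE' x y z X 1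
  have h4 := sum_e_tripleE_e' x y z X 1
  simp only [mul_one] at h1 h2 h3 h4
  simp only [Finset.sum_add_distrib, h1, h2, h3, h4, contrLeft, contrMid]
  have s1 : (z * x).trace = (x * z).trace := trace_mul_comm _ _
  have s2 : (z * y).trace = (y * z).trace := trace_mul_comm _ _
  simp only [add_mul, mul_sub, sub_mul, mul_one, one_mul, mul_assoc, mul_smul_comm,
    smul_mul_assoc, trace_one, hx, hy, hz, s1, s2, Fintype.card_fin]
  push_cast
  module

end ClosedForms

/-! ### Constituents of `J(x)` on matrices and their contractions -/

/-- The operator `X ↦ u X - X u`. -/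
def adOp : Mat →ₗ[ℂ] Module.End ℂ Mat := LinearMap.mul ℂ Mat - (LinearMap.mul ℂ Mat).flip

/-- The operator `X ↦ u X + X u`. -/
def acOp : Mat →ₗ[ℂ] Module.End ℂ Mat := LinearMap.mul ℂ Mat + (LinearMap.mul ℂ Mat).flip

/-- The operator `X ↦ tr (u X) - (tr X) u`. -/
def trOp : Mat →ₗ[ℂ] Module.End ℂ Mat :=
  LinearMap.mk₂ ℂ (fun u X => (u * X).trace • (1 : Mat) - X.trace • u)
    (fun u v X => by simp only [add_mul, trace_add]; module)
    (fun c u X => by simp only [smul_mul_assoc, trace_smul, smul_eq_mul]; module)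
    (fun u X Y => by simp only [mul_add, trace_add]; module)
    (fun c u X => by simp only [mul_smul_comm, trace_smul, smul_eq_mul]; module)

/-- The operator `X ↦ tr (x X) y - tr (y X) x`. -/
def pairOp (x y : Mat) : Module.End ℂ Mat where
  toFun X := (x * X).trace • y - (y * X).trace • x
  map_add' X Y := by simp only [mul_add, trace_add]; module
  map_smul' c X := by simp only [mul_smul_comm, trace_smul, smul_eq_mul, RingHom.id_apply]; module

theorem adOp_apply (u X : Mat) : adOp u X = u * X - X * u := rfl

theorem acOp_apply (u X : Mat) : acOp u X = u * X + X * u := rfl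

theorem trOp_apply (u X : Mat) : trOp u X = (u * X).trace • (1 : Mat) - X.trace • u := rfl

theorem pairOp_apply (x y X : Mat) : pairOp x y X = (x * X).trace • y - (y * X).trace • x := rfl

theorem comm_apply {M : Type*} [AddCommGroup M] [Module ℂ M] (f g : Module.End ℂ M) (X : M) :
    comm f g X = f (g X) - g (f X) := rfl

theorem pairOp_swap (x y : Mat) : pairOp y x = -pairOp x y := by
  ext1 X; simp only [pairOp_apply, LinearMap.neg_apply]; abel

/-- The contraction of `{adOp u, adOp v, B w}`. -/
def opSum (B : Mat →ₗ[ℂ] Module.End ℂ Mat) (x y z : Mat) : Module.End ℂ Mat :=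
  ∑ q : Fin 3 × Fin 3, ∑ p : Fin 3 × Fin 3,
    sym3 (adOp (e p.swap).1) (adOp (e q.swap).1) (B (tripleE x y z p q))

theorem opSum_add (B C : Mat →ₗ[ℂ] Module.End ℂ Mat) (x y z : Mat) :
    opSum (B + C) x y z = opSum B x y z + opSum C x y z := by
  simp only [opSum, ← Finset.sum_add_distrib]
  refine Finset.sum_congr rfl fun q _ => Finset.sum_congr rfl fun p _ => ?_
  simp only [sym3, LinearMap.add_apply, mul_add, add_mul]
  module

theorem opSum_smul (c : ℂ) (B : Mat →ₗ[ℂ] Module.End ℂ Mat) (x y z : Mat) :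
    opSum (c • B) x y z = c • opSum B x y z := by
  simp only [opSum, Finset.smul_sum]
  refine Finset.sum_congr rfl fun q _ => Finset.sum_congr rfl fun p _ => ?_
  simp only [sym3, LinearMap.smul_apply, mul_smul_comm, smul_mul_assoc]
  module

section

variable {x y z : Mat}

theorem opSum_apply (B : Mat →ₗ[ℂ] Module.End ℂ Mat) (x y z X : Mat) :
    opSum B x y z X = ∑ q : Fin 3 × Fin 3, ∑ p : Fin 3 × Fin 3,
    sym3 (adOp (e p.swap).1) (adOp (e q.swap).1) (B (tripleE x y z p q)) X := by
  simp only [opSum, LinearMap.sum_apply]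

theorem opSum_adOp (hx : x.trace = 0) (hy : y.trace = 0) (hz : z.trace = 0) :
    opSum adOp x y z = (3 / 4 : ℂ) • (pairOp x (y * z - z * y) + pairOp z (x * y - y * x) +
      pairOp y (z * x - x * z)) := by
  ext1 X
  have h0 := sum_sym_word hx hy hz
  have h1 := sum_e_e_X_tripleE z hx hy X
  have h2 := sum_e_tripleE_X_e hx hy hz X
  have h3 := sum_tripleE_X_e_e z hx hy X
  have h4 := sum_e_X_e_tripleE hx hy hz X
  -- Left and right multiplications commute, so a word with letters on both sides of `X` arises from
  -- three of the six orders. Each letter on the right contributes a sign.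
  have key : ∀ u v w : Mat, sym3 (adOp u) (adOp v) (adOp w) X = (1 / 24 : ℂ) •
      ((u * v * w + v * u * w + u * w * v + v * w * u + w * u * v + w * v * u) * X
      - X * (u * v * w + v * u * w + u * w * v + v * w * u + w * u * v + w * v * u)
      - (3 : ℂ) • (u * v * X * w + v * u * X * w)
      - (3 : ℂ) • (v * w * X * u + w * v * X * u + u * w * X * v + w * u * X * v)
      + (3 : ℂ) • (w * X * u * v + w * X * v * u)
      + (3 : ℂ) • (u * X * v * w + u * X * w * v + v * X * u * w + v * X * w * u)) := by
    intro u v w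
    simp only [sym3, LinearMap.smul_apply, LinearMap.add_apply, Module.End.mul_apply, adOp_apply,
      mul_sub, sub_mul, mul_add, add_mul, mul_assoc]
    module
  rw [opSum_apply]
  simp only [key, ← Finset.smul_sum]
  -- The prescribed shapes of `f` keep the bracketed groups of words together, so that `h0` to `h4`
  -- apply to them.
  simp only [Finset.sum_sub_distrib, Finset.sum_add_distrib (f := fun _ => _ - _),
    Finset.sum_add_distrib (f := fun _ => _ - _ + _), ← Finset.smul_sum, ← Finset.sum_mul,
    ← Finset.mul_sum, h0, h1, h2, h3, h4]
  simp only [LinearMap.smul_apply, LinearMap.add_apply, pairOp_apply, trace_mul_comm _ X]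
  simp only [mul_sub, sub_mul, mul_assoc, trace_sub, mul_zero, zero_mul]
  module

/-- The result has the same form in `acOp` as `opSum_trOp` has in `trOp`, so the two combine inside
`J`; only the `adOp` part leaves a correction. -/
theorem opSum_acOp (hx : x.trace = 0) (hy : y.trace = 0) (hz : z.trace = 0) :
    opSum acOp x y z = (3 / 4 : ℂ) • comm (pairOp x y) (acOp z) -
      (1 / 4 : ℂ) • acOp ((x * y - y * x) * z - z * (x * y - y * x)) := by
  ext1 X
  have h0 := sum_sym_word hx hy hz
  have h1 := sum_e_e_X_tripleE z hx hy X
  have h2 := sum_e_tripleE_X_e hx hy hz X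
  have h3 := sum_tripleE_X_e_e z hx hy X
  have h4 := sum_e_X_e_tripleE hx hy hz X
  have key : ∀ u v w : Mat, sym3 (adOp u) (adOp v) (acOp w) X = (1 / 24 : ℂ) •
      ((u * v * w + v * u * w + u * w * v + v * w * u + w * u * v + w * v * u) * X
      + X * (u * v * w + v * u * w + u * w * v + v * w * u + w * u * v + w * v * u)
      + (3 : ℂ) • (u * v * X * w + v * u * X * w)
      - (3 : ℂ) • (v * w * X * u + w * v * X * u + u * w * X * v + w * u * X * v)
      + (3 : ℂ) • (w * X * u * v + w * X * v * u)
      - (3 : ℂ) • (u * X * v * w + u * X * w * v + v * X * u * w + v * X * w * u)) := by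
    intro u v w
    simp only [sym3, LinearMap.smul_apply, LinearMap.add_apply, Module.End.mul_apply, adOp_apply,
      acOp_apply, mul_sub, sub_mul, mul_add, add_mul, mul_assoc]
    module
  rw [opSum_apply]
  simp only [key, ← Finset.smul_sum]
  simp only [Finset.sum_sub_distrib, Finset.sum_add_distrib (f := fun _ => _ * X),
    Finset.sum_add_distrib (f := fun _ => _ * X + _ * _),
    Finset.sum_add_distrib (f := fun _ => _ - _), ← Finset.smul_sum, ← Finset.sum_mul,
    ← Finset.mul_sum, h0, h1, h2, h3, h4]
  have r1 : ∀ A : Mat, (A * X).trace = (X * A).trace := fun A => trace_mul_comm _ _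
  have r2 : ∀ A B : Mat, (A * (X * B)).trace = (X * (B * A)).trace := fun A B => by
    rw [trace_mul_comm, mul_assoc]
  have r3 : ∀ A B : Mat, (A * (B * X)).trace = (X * (A * B)).trace := fun A B => by
    rw [← mul_assoc, trace_mul_comm]
  simp only [LinearMap.smul_apply, LinearMap.sub_apply, comm_apply, pairOp_apply, acOp_apply]
  simp only [mul_sub, sub_mul, mul_add, mul_smul_comm, smul_mul_assoc, mul_assoc, trace_add,
    mul_zero, zero_mul, r1, r2, r3]
  module

theorem opSum_trOp (hx : x.trace = 0) (hy : y.trace = 0) (hz : z.trace = 0) :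
    opSum trOp x y z = (3 / 4 : ℂ) • comm (pairOp x y) (trOp z) -
      (1 / 4 : ℂ) • trOp ((x * y - y * x) * z - z * (x * y - y * x)) := by
  ext1 X
  have h := sum_commutator_word hx hy hz
  -- Orders with `trOp w` in the middle vanish, since `adOp u` kills scalars and has traceless
  -- values. In the others the commutators fall on `w`.
  have key : ∀ u v w : Mat, sym3 (adOp u) (adOp v) (trOp w) X = (1 / 24 : ℂ) •
      ((u * v * w - u * w * v - v * w * u + w * v * u + v * u * w - v * w * u - u * w * v
        + w * u * v) * X).trace • (1 : Mat)
      - (1 / 24 : ℂ) • X.trace •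
      (u * v * w - u * w * v - v * w * u + w * v * u + v * u * w - v * w * u - u * w * v
        + w * u * v) := by
    intro u v w
    have r1 : ∀ A : Mat, (A * X).trace = (X * A).trace := fun A => trace_mul_comm _ _
    have r2 : ∀ A B : Mat, (A * (X * B)).trace = (X * (B * A)).trace := fun A B => by
      rw [trace_mul_comm, mul_assoc]
    have r3 : ∀ A B : Mat, (A * (B * X)).trace = (X * (A * B)).trace := fun A B => by
      rw [← mul_assoc, trace_mul_comm]
    have r4 : ∀ A B C : Mat, (A * (B * (X * C))).trace = (X * (C * (A * B))).trace := fun A B C => by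
      rw [← mul_assoc, trace_mul_comm, mul_assoc]
    have r5 : ∀ A B C : Mat, (A * (B * (C * X))).trace = (X * (A * (B * C))).trace :=
      fun A B C => by rw [← mul_assoc, ← mul_assoc, trace_mul_comm, mul_assoc A]
    simp only [sym3, LinearMap.smul_apply, LinearMap.add_apply, Module.End.mul_apply, adOp_apply,
      trOp_apply, mul_sub, sub_mul, add_mul, mul_assoc, mul_smul_comm, smul_mul_assoc,
      mul_one, one_mul, trace_sub, trace_add, r1, r2, r3, r4, r5]
    module
  rw [opSum_apply]
  simp only [key, Finset.sum_sub_distrib, ← Finset.smul_sum, ← Finset.sum_smul, ← trace_sum,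
    ← Finset.sum_mul, h]
  simp only [LinearMap.smul_apply, LinearMap.sub_apply, comm_apply, pairOp_apply, trOp_apply]
  simp only [mul_sub, sub_mul, mul_smul_comm, smul_mul_assoc, mul_assoc, trace_sub, trace_smul,
    mul_one, hx, hy, trace_mul_comm z x, trace_mul_comm z y, smul_eq_mul]
  module

end

/-! ### Representations from operators satisfying the relations -/

theorem form_lie_lie (x y z u v w : sl3) :
    form ⁅x, u⁆ ⁅⁅y, v⁆, ⁅z, w⁆⁆ = form w ⁅⁅⁅x, u⁆, ⁅y, v⁆⁆, z⁆ := by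
  have inv : ∀ a b c : sl3, form a ⁅b, c⁆ = form ⁅a, b⁆ c := by
    intro a b c
    change (a.1 * (b.1 * c.1 - c.1 * b.1)).trace = ((a.1 * b.1 - b.1 * a.1) * c.1).trace
    rw [mul_sub, sub_mul, trace_sub, trace_sub, mul_assoc, ← mul_assoc a.1 c.1,
      trace_mul_comm (a.1 * c.1), mul_assoc]
  have symm : ∀ a b : sl3, form a b = form b a := fun a b => trace_mul_comm _ _
  rw [inv, inv, symm]

section Presentation

variable {A : Type*} [Ring A] [Algebra ℂ A]

/-- The contraction `∑ c {i x_λ, i x_μ, j x_ν}` of the structure coefficients. -/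
def drinfeldSum (i j : sl3 →ₗ[ℂ] A) (x y z : sl3) : A :=
  ∑ q : Fin 3 × Fin 3, ∑ p : Fin 3 × Fin 3,
    sym3 (i (e p.swap)) (i (e q.swap)) (j ⁅⁅⁅x, e p⁆, ⁅y, e q⁆⁆, z⁆)

/-- The symmetrized product as a linear map in its last argument. -/
def sym3Right (u v : A) : A →ₗ[ℂ] A where
  toFun := sym3 u v
  map_add' a b := by simp only [sym3, mul_add, add_mul]; module
  map_smul' c a := by
    simp only [sym3, mul_smul_comm, smul_mul_assoc, RingHom.id_apply]; module

/-- By invariance the coefficient is the pairing of `e r` with `[[[x, e p], [y, e q]], z]`, so the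
sum over `r` reproduces that element in the last slot. -/
theorem sum_coeff_smul_sym3 (i j : sl3 →ₗ[ℂ] A) (x y z : sl3) :
    ∑ p, ∑ q, ∑ r, coeff x y z p q r • sym3 (i (e p.swap)) (i (e q.swap)) (j (e r.swap)) =
      drinfeldSum i j x y z := by
  rw [drinfeldSum, Finset.sum_comm]
  refine Finset.sum_congr rfl fun q _ => Finset.sum_congr rfl fun p _ => ?_
  have h := congrArg ((sym3Right (i (e p.swap)) (i (e q.swap))).comp j)
    (sum_form_e_smul ⁅⁅⁅x, e p⁆, ⁅y, e q⁆⁆, z⁆)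
  simp only [map_sum, map_smul] at h
  refine Eq.trans (Finset.sum_congr rfl fun r _ => ?_) h
  rw [coeff, form_lie_lie]
  rfl

theorem drinfeldSum_smul (c : ℂ) (i j : sl3 →ₗ[ℂ] A) (x y z : sl3) :
    drinfeldSum i (c • j) x y z = c • drinfeldSum i j x y z := by
  simp only [drinfeldSum, Finset.smul_sum]
  exact Finset.sum_congr rfl fun q _ => Finset.sum_congr rfl fun p _ =>
    (sym3Right (i (e p.swap)) (i (e q.swap))).map_smul c _

theorem exists_algHom (i j : sl3 →ₗ[ℂ] A)
    (hi : ∀ x y, comm (i x) (i y) = i ⁅x, y⁆) (hj : ∀ x y, comm (i x) (j y) = j ⁅x, y⁆)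
    (cubic : ∀ x y z, comm (j x) (j ⁅y, z⁆) + comm (j z) (j ⁅x, y⁆) + comm (j y) (j ⁅z, x⁆) =
      drinfeldSum i i x y z)
    (quartic : ∀ x y z w, comm (comm (j x) (j y)) (j ⁅z, w⁆) + comm (comm (j z) (j w)) (j ⁅x, y⁆) =
      drinfeldSum i j x y ⁅z, w⁆ + drinfeldSum i j z w ⁅x, y⁆) :
    ∃ ρ : Yangian →ₐ[ℂ] A, ∀ x, ρ (I x) = i x ∧ ρ (J x) = j x := by
  let f : Free →ₐ[ℂ] A := FreeAlgebra.lift ℂ fun s : Gen =>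
    match s with
    | Gen.I x => i x
    | Gen.J x => j x
  have fI_eq : ∀ x, f (fI x) = i x := fun x => FreeAlgebra.lift_ι_apply _ _
  have fJ_eq : ∀ x, f (fJ x) = j x := fun x => FreeAlgebra.lift_ι_apply _ _
  have f_comm : ∀ a b, f (comm a b) = comm (f a) (f b) := fun a b => by simp [comm]
  have f_sym : ∀ a b c, f (sym3 a b c) = sym3 (f a) (f b) (f c) := fun a b c => by
    simp only [sym3, map_smul, map_add, map_mul]
  have hf : ∀ ⦃a b : Free⦄, Rel a b → f a = f b := by
    intro a b h
    induction h with
    | I_add x y => simp only [map_add, fI_eq]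
    | I_smul c x => simp only [map_smul, fI_eq]
    | I_lie x y => simp only [f_comm, fI_eq, hi]
    | J_add x y => simp only [map_add, fJ_eq]
    | J_smul c x => simp only [map_smul, fJ_eq]
    | I_J x y => simp only [f_comm, fI_eq, fJ_eq, hj]
    | cubic x y z =>
      simp only [map_add, map_sum, map_smul, f_comm, f_sym, fI_eq, fJ_eq, sum_coeff_smul_sym3,
        cubic]
    | quartic x y z w =>
      simp only [map_add, map_sum, map_smul, f_comm, f_sym, fI_eq, fJ_eq, add_smul,
        Finset.sum_add_distrib, sum_coeff_smul_sym3, hj, quartic]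
  refine ⟨RingQuot.liftAlgHom ℂ ⟨f, hf⟩, fun x => ⟨?_, ?_⟩⟩
  · exact (RingQuot.liftAlgHom_mkAlgHom_apply ℂ f hf _).trans (fI_eq x)
  · exact (RingQuot.liftAlgHom_mkAlgHom_apply ℂ f hf _).trans (fJ_eq x)

theorem comm_smul_smul (c d : ℂ) (u v : A) : comm (c • u) (d • v) = (c * d) • comm u v := by
  simp only [comm, smul_mul_assoc, mul_smul_comm]; module

/-- The left side of the cubic relation is `a²` times a Jacobi sum, and that of the quartic is `a³`
times `[[x, y], [z, w]] + [[z, w], [x, y]] = 0`. Both right sides vanish by hypothesis. -/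
theorem exists_evaluation_algHom (i : sl3 →ₗ[ℂ] A) (hi : ∀ x y, comm (i x) (i y) = i ⁅x, y⁆)
    (h : ∀ x y z, drinfeldSum i i x y z = 0) (a : ℂ) :
    ∃ ρ : Yangian →ₐ[ℂ] A, ∀ x, ρ (I x) = i x ∧ ρ (J x) = a • i x := by
  refine exists_algHom i (a • i) hi (fun x y => ?_) (fun x y z => ?_) (fun x y z w => ?_)
  · have := comm_smul_smul 1 a (i x) (i y)
    simpa [hi] using this
  · simp only [LinearMap.smul_apply, comm_smul_smul, hi, h, ← smul_add, ← map_add]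
    rw [add_right_comm, lie_jacobi, map_zero, smul_zero]
  · simp only [LinearMap.smul_apply, comm_smul_smul, hi, h, drinfeldSum_smul, ← smul_add,
      ← map_add]
    rw [← lie_skew ⁅x, y⁆ ⁅z, w⁆]
    simp

end Presentation

/-! ### The representations on `V`, on its dual and on `ℂ` -/

section Evaluation

theorem vecAction_mul (x y : sl3) : vecAction x * vecAction y = toLin' (x.1 * y.1) :=
  (toLin'_mul _ _).symm

theorem sum_sym3_e (x y z : sl3) :
    ∑ q : Fin 3 × Fin 3, ∑ p : Fin 3 × Fin 3,
      sym3 (e p.swap).1 (e q.swap).1 (tripleE x.1 y.1 z.1 p q) = 0 := by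
  have h := congrArg (fun M => (1 / 24 : ℂ) • M) (sum_sym_word (z := z.1) x.2 y.2 z.2)
  simp only [smul_zero, Finset.smul_sum] at h
  refine Eq.trans (Finset.sum_congr rfl fun q _ => Finset.sum_congr rfl fun p _ => ?_) h
  generalize tripleE x.1 y.1 z.1 p q = w
  generalize (e p.swap).1 = u
  generalize (e q.swap).1 = v
  simp only [sym3]
  module

/-- The vector representation as a linear map. -/
def vecLin : sl3 →ₗ[ℂ] Module.End ℂ V where
  toFun := vecAction
  map_add' x y := map_add toLin' x.1 y.1
  map_smul' c x := map_smul toLin' c x.1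

/-- The transpose action of a matrix on the dual space. -/
def dualMat : Mat →ₗ[ℂ] Module.End ℂ VDual where
  toFun M := (toLin' M).dualMap
  map_add' M N := by ext f v; simp
  map_smul' c M := by ext f v; simp

theorem dualMat_mul (M N : Mat) : dualMat M * dualMat N = dualMat (N * M) := by
  ext f v
  simp [dualMat]

/-- The dual representation as a linear map. -/
def dualLin : sl3 →ₗ[ℂ] Module.End ℂ VDual where
  toFun := dualAction
  map_add' x y := by
    change -dualMat (x.1 + y.1) = -dualMat x.1 + -dualMat y.1
    rw [map_add, neg_add]
  map_smul' c x := by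
    change -dualMat (c • x.1) = c • -dualMat x.1
    rw [map_smul, smul_neg]

theorem exists_vec (a : ℂ) :
    ∃ ρ : Yangian →ₐ[ℂ] Module.End ℂ V, IsEvaluation vecAction a ρ := by
  refine exists_evaluation_algHom vecLin (fun x y => ?_) (fun x y z => ?_) a
  · change vecAction x * vecAction y - vecAction y * vecAction x = toLin' (x.1 * y.1 - y.1 * x.1)
    rw [vecAction_mul, vecAction_mul, map_sub]
  · have h := congrArg (toLinAlgEquiv' (R := ℂ) (n := Fin 3)) (sum_sym3_e x y z)
    simp only [sym3, map_sum, map_smul, map_add, map_mul, map_zero] at h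
    exact h

section Antihomomorphism

variable {A : Type*} [Ring A] [Algebra ℂ A] {d : Mat →ₗ[ℂ] A}

theorem comm_neg_of_antihom (hd : ∀ M N, d M * d N = d (N * M)) (M N : Mat) :
    comm (-d M) (-d N) = -d (M * N - N * M) := by
  simp only [comm, neg_mul_neg, hd, map_sub]
  abel

/-- Reversing the order of factors permutes the six words of `sym3`, and three signs leave one. The
vanishing on `V` thus passes to the dual. -/
theorem sym3_neg_of_antihom (hd : ∀ M N, d M * d N = d (N * M)) (u v w : Mat) :
    sym3 (-d u) (-d v) (-d w) = -d (sym3 u v w) := by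
  simp only [sym3, mul_neg, neg_mul, neg_neg, hd, map_smul, map_add, mul_assoc]
  module

end Antihomomorphism

theorem exists_dual (b : ℂ) :
    ∃ ρ : Yangian →ₐ[ℂ] Module.End ℂ VDual, IsEvaluation dualAction b ρ := by
  refine exists_evaluation_algHom dualLin (fun x y => ?_) (fun x y z => ?_) b
  · exact comm_neg_of_antihom dualMat_mul x.1 y.1
  · have h := congrArg (fun M => -dualMat M) (sum_sym3_e x y z)
    rw [map_zero, neg_zero, map_sum] at h
    simp only [map_sum] at h
    have h2 : ∀ p q, sym3 (dualLin (e p.swap)) (dualLin (e q.swap))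
        (dualLin ⁅⁅⁅x, e p⁆, ⁅y, e q⁆⁆, z⁆) = -dualMat
          (sym3 (e p.swap).1 (e q.swap).1 (tripleE x.1 y.1 z.1 p q)) := fun p q =>
      sym3_neg_of_antihom dualMat_mul _ _ _
    simp only [drinfeldSum, h2]
    rw [← h, ← Finset.sum_neg_distrib]
    exact Finset.sum_congr rfl fun q _ => Finset.sum_neg_distrib _

theorem exists_trivial :
    ∃ ρ : Yangian →ₐ[ℂ] Module.End ℂ ℂ, IsEvaluation (0 : sl3 → Module.End ℂ ℂ) 0 ρ := by
  refine exists_evaluation_algHom (0 : sl3 →ₗ[ℂ] Module.End ℂ ℂ) (fun x y => ?_)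
    (fun x y z => ?_) 0
  · simp [comm]
  · simp [drinfeldSum, sym3]

end Evaluation

/-! ### The tensor product representation on matrices -/

section CommLinear

variable {A : Type*} [Ring A]

theorem comm_add_left (u v w : A) : comm (u + v) w = comm u w + comm v w := by
  simp only [comm, add_mul, mul_add]; abel

theorem comm_add_right (u v w : A) : comm u (v + w) = comm u v + comm u w := by
  simp only [comm, add_mul, mul_add]; abel

theorem comm_swap (u v : A) : comm v u = -comm u v := by simp [comm]

variable [Algebra ℂ A]

theorem comm_smul_left (c : ℂ) (u v : A) : comm (c • u) v = c • comm u v := by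
  simp only [comm, smul_mul_assoc, mul_smul_comm]; module

theorem comm_smul_right (c : ℂ) (u v : A) : comm u (c • v) = c • comm u v := by
  simp only [comm, smul_mul_assoc, mul_smul_comm]; module

end CommLinear

/-- The inclusion of `sl(3)` into the matrices. -/
def coeLin : sl3 →ₗ[ℂ] Mat where
  toFun x := x.1
  map_add' _ _ := rfl
  map_smul' _ _ := rfl

/-- The adjoint action of `sl(3)` on matrices. -/
def tensI : sl3 →ₗ[ℂ] Module.End ℂ Mat := adOp.comp coeLin

/-- The operator by which `J(x)` acts on matrices. -/
def jOp (a b : ℂ) : Mat →ₗ[ℂ] Module.End ℂ Mat :=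
  ((a + b) / 2) • adOp + ((a - b) / 2) • acOp + (1 / 2 : ℂ) • trOp

/-- The action of `J(x)` on matrices, for `x` in `sl(3)`. -/
def tensJ (a b : ℂ) : sl3 →ₗ[ℂ] Module.End ℂ Mat := (jOp a b).comp coeLin

/-- The operator `X ↦ tr (x X) y - tr (y X) x`, for `x`, `y` in `sl(3)`. -/
def pair (x y : sl3) : Module.End ℂ Mat := pairOp x.1 y.1

theorem coe_lie (x y : sl3) : (⁅x, y⁆ : sl3).1 = x.1 * y.1 - y.1 * x.1 := rfl

theorem tensI_apply (x : sl3) (X : Mat) : tensI x X = x.1 * X - X * x.1 := rfl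

theorem tensJ_apply (a b : ℂ) (x : sl3) (X : Mat) :
    tensJ a b x X = a • (x.1 * X) - b • (X * x.1) +
      (1 / 2 : ℂ) • ((x.1 * X).trace • (1 : Mat) - X.trace • x.1) := by
  change ((a + b) / 2) • (x.1 * X - X * x.1) + ((a - b) / 2) • (x.1 * X + X * x.1) +
      (1 / 2 : ℂ) • ((x.1 * X).trace • (1 : Mat) - X.trace • x.1) = _
  module

theorem pair_apply (x y : sl3) (X : Mat) :
    pair x y X = (x.1 * X).trace • y.1 - (y.1 * X).trace • x.1 := rfl

theorem comm_tensI_tensI (x y : sl3) : comm (tensI x) (tensI y) = tensI ⁅x, y⁆ := by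
  ext1 X
  simp only [comm_apply, tensI_apply, coe_lie]
  noncomm_ring

theorem comm_tensI_tensJ (a b : ℂ) (x y : sl3) :
    comm (tensI x) (tensJ a b y) = tensJ a b ⁅x, y⁆ := by
  ext1 X
  have r : (y.1 * (X * x.1)).trace = (x.1 * (y.1 * X)).trace := by
    rw [← mul_assoc, trace_mul_comm]
  simp only [comm_apply, tensI_apply, tensJ_apply, coe_lie, mul_add, mul_sub, add_mul, sub_mul,
    mul_smul_comm, smul_mul_assoc, mul_one, one_mul, trace_sub, mul_assoc, trace_mul_comm X x.1, r]
  module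

/-- The multiplication parts give `a²` on the left and `-b²` on the right, and both `a` and `b` are
roots of `t² = (a + b) t - ab`. The constant `3/4` is `tr(1)/4`, from the two trace terms of
coefficient `1/2`. -/
theorem comm_tensJ_tensJ (a b : ℂ) (x y : sl3) : comm (tensJ a b x) (tensJ a b y) =
    (a + b) • tensJ a b ⁅x, y⁆ - (a * b) • tensI ⁅x, y⁆ + (3 / 4 : ℂ) • pair x y := by
  ext1 X
  have hx : Matrix.trace x.1 = 0 := x.2
  have hy : Matrix.trace y.1 = 0 := y.2
  have r : (y.1 * (X * x.1)).trace = (x.1 * (y.1 * X)).trace := by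
    rw [← mul_assoc, trace_mul_comm]
  have r' : (x.1 * (X * y.1)).trace = (y.1 * (x.1 * X)).trace := by
    rw [← mul_assoc, trace_mul_comm]
  simp only [LinearMap.add_apply, LinearMap.sub_apply, LinearMap.smul_apply, comm_apply,
    tensI_apply, tensJ_apply, pair_apply, coe_lie, mul_add, mul_sub, add_mul, sub_mul,
    mul_smul_comm, smul_mul_assoc, mul_one, one_mul, trace_add, trace_sub, trace_smul, mul_assoc,
    trace_mul_comm X x.1, trace_mul_comm X y.1, trace_mul_comm y.1 x.1, r, r', hx, hy, trace_one,
    Fintype.card_fin, smul_eq_mul]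
  push_cast
  module

theorem pair_swap (x y : sl3) : pair y x = -pair x y := pairOp_swap x.1 y.1

/-- This expresses that `pair` is equivariant and alternating. -/
theorem comm_pair_tensI (x y z : sl3) :
    comm (pair x y) (tensI z) = pair x ⁅y, z⁆ + pair y ⁅z, x⁆ := by
  ext1 X
  have r : ∀ A B : Mat, (A * (X * B)).trace = (B * (A * X)).trace := fun A B => by
    rw [← mul_assoc, trace_mul_comm]
  simp only [LinearMap.add_apply, comm_apply, tensI_apply, pair_apply, coe_lie, mul_sub, sub_mul,
    mul_smul_comm, smul_mul_assoc, trace_sub, mul_assoc, r]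
  module

theorem drinfeldSum_tensI (x y z : sl3) : drinfeldSum tensI tensI x y z =
    (3 / 4 : ℂ) • (pair x ⁅y, z⁆ + pair z ⁅x, y⁆ + pair y ⁅z, x⁆) :=
  opSum_adOp x.2 y.2 z.2

/-- Apart from the first term, everything is antisymmetric under exchange of `[x, y]` and `z`, and
so cancels in the quartic relation. -/
theorem drinfeldSum_tensJ (a b : ℂ) (x y z : sl3) : drinfeldSum tensI (tensJ a b) x y z =
    (3 / 4 : ℂ) • comm (pair x y) (tensJ a b z) - (1 / 4 : ℂ) • tensJ a b ⁅⁅x, y⁆, z⁆ +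
      ((a + b) / 2) • ((3 / 4 : ℂ) • pair z ⁅x, y⁆ + (1 / 4 : ℂ) • tensI ⁅⁅x, y⁆, z⁆) := by
  have h1 : drinfeldSum tensI (tensJ a b) x y z = opSum (jOp a b) x.1 y.1 z.1 := rfl
  have h2 := comm_pair_tensI x y z
  have h3 : ∀ u : sl3, tensJ a b u = ((a + b) / 2) • adOp u.1 + ((a - b) / 2) • acOp u.1 +
    (1 / 2 : ℂ) • trOp u.1 := fun _ => rfl
  have h4 : opSum adOp x.1 y.1 z.1 = (3 / 4 : ℂ) • (comm (pair x y) (adOp z.1) + pair z ⁅x, y⁆) := by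
    refine (drinfeldSum_tensI x y z).trans ?_
    change _ = (3 / 4 : ℂ) • (comm (pair x y) (tensI z) + pair z ⁅x, y⁆)
    rw [h2]
    module
  have h5 : opSum acOp x.1 y.1 z.1 = (3 / 4 : ℂ) • comm (pair x y) (acOp z.1) -
      (1 / 4 : ℂ) • acOp (⁅⁅x, y⁆, z⁆ : sl3).1 := opSum_acOp x.2 y.2 z.2
  have h6 : opSum trOp x.1 y.1 z.1 = (3 / 4 : ℂ) • comm (pair x y) (trOp z.1) -
      (1 / 4 : ℂ) • trOp (⁅⁅x, y⁆, z⁆ : sl3).1 := opSum_trOp x.2 y.2 z.2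
  have h7 : tensI ⁅⁅x, y⁆, z⁆ = adOp (⁅⁅x, y⁆, z⁆ : sl3).1 := rfl
  rw [h1, jOp, opSum_add, opSum_add, opSum_smul, opSum_smul, opSum_smul, h4, h5, h6, h7, h3, h3]
  simp only [comm_add_right, comm_smul_right]
  module

theorem exists_tens (a b : ℂ) : ∃ ρ : Yangian →ₐ[ℂ] Module.End ℂ Mat,
    ∀ x, ρ (I x) = tensI x ∧ ρ (J x) = tensJ a b x := by
  refine exists_algHom tensI (tensJ a b) comm_tensI_tensI (comm_tensI_tensJ a b)
    (fun x y z => ?_) (fun x y z w => ?_)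
  · have jac : ⁅x, ⁅y, z⁆⁆ + ⁅z, ⁅x, y⁆⁆ + ⁅y, ⁅z, x⁆⁆ = 0 := by
      rw [add_right_comm, lie_jacobi]
    have hI := congrArg tensI jac
    have hJ := congrArg (tensJ a b) jac
    simp only [map_add, map_zero] at hI hJ
    rw [drinfeldSum_tensI]
    simp only [comm_tensJ_tensJ]
    -- The Jacobi identity kills the `J` and `I` parts; the cyclic sum of `pair` is the right side
    -- of the cubic relation.
    refine Eq.trans (b := (a + b) • (tensJ a b ⁅x, ⁅y, z⁆⁆ + tensJ a b ⁅z, ⁅x, y⁆⁆ +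
      tensJ a b ⁅y, ⁅z, x⁆⁆) - (a * b) • (tensI ⁅x, ⁅y, z⁆⁆ + tensI ⁅z, ⁅x, y⁆⁆ +
      tensI ⁅y, ⁅z, x⁆⁆) + (3 / 4 : ℂ) • (pair x ⁅y, z⁆ + pair z ⁅x, y⁆ + pair y ⁅z, x⁆)) ?_ ?_
    · module
    · rw [hI, hJ, smul_zero, smul_zero, sub_zero, zero_add]
  · generalize hu : ⁅z, w⁆ = u
    generalize hv : ⁅x, y⁆ = v
    have hI : tensI ⁅u, v⁆ = -tensI ⁅v, u⁆ := by rw [← map_neg, lie_skew]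
    have hJ : tensJ a b ⁅u, v⁆ = -tensJ a b ⁅v, u⁆ := by rw [← map_neg, lie_skew]
    have main : ∀ x y u, comm (comm (tensJ a b x) (tensJ a b y)) (tensJ a b u) =
        (a + b) • comm (tensJ a b ⁅x, y⁆) (tensJ a b u) - (a * b) • tensJ a b ⁅⁅x, y⁆, u⁆
          + (3 / 4 : ℂ) • comm (pair x y) (tensJ a b u) := by
      intro x y u
      rw [comm_tensJ_tensJ, sub_eq_add_neg, ← neg_one_smul ℂ, smul_smul, comm_add_left, comm_add_left,
        comm_smul_left, comm_smul_left, comm_smul_left, comm_tensI_tensJ]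
      module
    -- Terms antisymmetric in `u` and `v` cancel, leaving `3/4` times the commutators of `pair` with
    -- `J` on both sides.
    rw [main, main, drinfeldSum_tensJ, drinfeldSum_tensJ, hu, hv, hI, hJ, pair_swap u v,
      comm_swap (tensJ a b u)]
    module

/-! ### The tensor product of the evaluation representations -/

/-- The identification of `V ⊗ V*` with matrices. -/
def toMat : V ⊗[ℂ] VDual ≃ₗ[ℂ] Mat :=
  (TensorProduct.comm ℂ V VDual) ≪≫ₗ (dualTensorHomEquiv ℂ V V) ≪≫ₗ LinearMap.toMatrix'

theorem toMat_vecAction_tmul (x : sl3) (v : V) (f : VDual) :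
    toMat (vecAction x v ⊗ₜ f) = x.1 * toMat (v ⊗ₜ f) := by
  apply toLin'.injective
  rw [toLin'_mul]
  simp only [toMat, LinearEquiv.trans_apply, TensorProduct.comm_tmul, toLin'_toMatrix']
  apply LinearMap.ext
  intro w
  simp [vecAction]

theorem toMat_tmul_dualAction (x : sl3) (v : V) (f : VDual) :
    toMat (v ⊗ₜ dualAction x f) = -(toMat (v ⊗ₜ f) * x.1) := by
  apply toLin'.injective
  rw [map_neg, toLin'_mul]
  simp only [toMat, LinearEquiv.trans_apply, TensorProduct.comm_tmul, toLin'_toMatrix']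
  apply LinearMap.ext
  intro w
  simp [vecAction, dualAction]

/-- The action of `End V ⊗ End V*` on matrices. -/
def endMat : Module.End ℂ V ⊗[ℂ] Module.End ℂ VDual →ₐ[ℂ] Module.End ℂ Mat :=
  (toMat.conjAlgEquiv ℂ).toAlgHom.comp (Module.endTensorEndAlgHom (R := ℂ) (S := ℂ) (A := ℂ))

theorem endMat_toMat (g : Module.End ℂ V) (h : Module.End ℂ VDual) (v : V) (f : VDual) :
    endMat (g ⊗ₜ h) (toMat (v ⊗ₜ f)) = toMat (g v ⊗ₜ h f) := by
  change toMat (TensorProduct.map g h (toMat.symm (toMat (v ⊗ₜ f)))) = _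
  rw [LinearEquiv.symm_apply_apply, TensorProduct.map_tmul]

theorem mat_induction {P : Mat → Prop} (h : ∀ v f, P (toMat (v ⊗ₜ f)))
    (h0 : P 0) (hadd : ∀ X Y, P X → P Y → P (X + Y)) (X : Mat) : P X := by
  obtain ⟨t, rfl⟩ := toMat.surjective X
  induction t with
  | zero => rw [map_zero]; exact h0
  | tmul v f => exact h v f
  | add s t hs ht => rw [map_add]; exact hadd _ _ hs ht

theorem endMat_vecAction (x : sl3) (X : Mat) : endMat (vecAction x ⊗ₜ 1) X = x.1 * X := by
  induction X using mat_induction with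
  | h v f => rw [endMat_toMat, toMat_vecAction_tmul, Module.End.one_apply]
  | h0 => rw [map_zero, mul_zero]
  | hadd X Y hX hY => rw [map_add, hX, hY, mul_add]

theorem endMat_dualAction (x : sl3) (X : Mat) : endMat (1 ⊗ₜ dualAction x) X = -(X * x.1) := by
  induction X using mat_induction with
  | h v f => rw [endMat_toMat, toMat_tmul_dualAction, Module.End.one_apply]
  | h0 => rw [map_zero, zero_mul, neg_zero]
  | hadd X Y hX hY => rw [map_add, hX, hY, add_mul, neg_add]

theorem endMat_vecAction_dualAction (x y : sl3) (X : Mat) :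
    endMat (vecAction x ⊗ₜ dualAction y) X = -(x.1 * X * y.1) := by
  have h : vecAction x ⊗ₜ[ℂ] dualAction y = (vecAction x ⊗ₜ 1) * (1 ⊗ₜ dualAction y) := by
    rw [Algebra.TensorProduct.tmul_mul_tmul, mul_one, one_mul]
  rw [h, map_mul, Module.End.mul_apply, endMat_dualAction, endMat_vecAction, mul_neg, mul_assoc]

theorem sum_e_mul_e (X : Mat) :
    ∑ p : Fin 3 × Fin 3, (e p).1 * X * (e p.swap).1 =
      X.trace • (1 : Mat) - (1 / 3 : ℂ) • X := by
  ext i j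
  simp only [Fintype.sum_prod_type, Fin.sum_univ_three, Matrix.add_apply]
  fin_cases i <;> fin_cases j <;>
    simp [e, traceless, Matrix.mul_apply, Fin.sum_univ_three, Matrix.trace_fin_three,
      Matrix.single_apply, Matrix.one_apply] <;> ring

theorem exists_tensorProduct {a b : ℂ} {ρ₁ : Yangian →ₐ[ℂ] Module.End ℂ V}
    {ρ₂ : Yangian →ₐ[ℂ] Module.End ℂ VDual} (h₁ : IsEvaluation vecAction a ρ₁)
    (h₂ : IsEvaluation dualAction b ρ₂) :
    ∃ ρ : Yangian →ₐ[ℂ] Module.End ℂ (V ⊗[ℂ] VDual), IsTensorProduct ρ₁ ρ₂ ρ ∧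
      ∀ x t, toMat (ρ (I x) t) = tensI x (toMat t) ∧ toMat (ρ (J x) t) = tensJ a b x (toMat t) := by
  obtain ⟨ρ, hρ⟩ := exists_tens a b
  refine ⟨(toMat.conjAlgEquiv ℂ).symm.toAlgHom.comp ρ, fun f => ?_, fun x t => ⟨?_, ?_⟩⟩
  -- Both sides are algebra maps on the free algebra, so it suffices to compare them on the
  -- generating symbols.
  · have key : ρ.comp mk =
        (endMat.comp (Algebra.TensorProduct.map ρ₁ ρ₂)).comp coproduct := by
      apply FreeAlgebra.hom_ext
      funext s
      cases s with
      | I x =>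
        have hc : coproduct (FreeAlgebra.ι ℂ (Gen.I x)) = I x ⊗ₜ 1 + 1 ⊗ₜ I x :=
          FreeAlgebra.lift_ι_apply _ _
        change ρ (I x) = endMat (Algebra.TensorProduct.map ρ₁ ρ₂
          (coproduct (FreeAlgebra.ι ℂ (Gen.I x))))
        ext1 X
        simp only [hc, (hρ x).1, map_add, Algebra.TensorProduct.map_tmul, map_one, (h₁ x).1,
          (h₂ x).1, LinearMap.add_apply, endMat_vecAction, endMat_dualAction, tensI_apply]
        abel
      | J x =>
        have hc : coproduct (FreeAlgebra.ι ℂ (Gen.J x)) = J x ⊗ₜ 1 + 1 ⊗ₜ J x +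
            (1 / 2 : ℂ) • comm (I x ⊗ₜ[ℂ] (1 : Yangian)) (∑ p, I (e p) ⊗ₜ[ℂ] I (e p.swap)) :=
          FreeAlgebra.lift_ι_apply _ _
        change ρ (J x) = endMat (Algebra.TensorProduct.map ρ₁ ρ₂
          (coproduct (FreeAlgebra.ι ℂ (Gen.J x))))
        ext1 X
        simp only [hc, (hρ x).2, comm, map_add, map_sub, map_mul, map_sum, map_smul,
          Algebra.TensorProduct.map_tmul, map_one, fun y => (h₁ y).1, fun y => (h₁ y).2,
          fun y => (h₂ y).1, fun y => (h₂ y).2, ← TensorProduct.smul_tmul',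
          TensorProduct.tmul_smul, LinearMap.add_apply, LinearMap.sub_apply, LinearMap.smul_apply,
          LinearMap.sum_apply, Module.End.mul_apply, endMat_vecAction, endMat_dualAction,
          endMat_vecAction_dualAction, Finset.sum_neg_distrib, sum_e_mul_e, tensJ_apply]
        simp only [mul_neg, mul_sub, mul_smul_comm, mul_one]
        module
    have h := congrArg (fun g => (toMat.conjAlgEquiv ℂ).symm (g f)) key
    refine h.trans ?_
    exact (toMat.conjAlgEquiv ℂ).symm_apply_apply _
  · rw [← (hρ x).1]
    exact toMat.apply_symm_apply _
  · rw [← (hρ x).2]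
    exact toMat.apply_symm_apply _

/-! ### Subspaces of matrices that are stable under the adjoint action -/

section AdjointStable

/-- The off-diagonal matrix unit as an element of `sl(3)`. -/
def unit {i j : Fin 3} (h : i ≠ j) : sl3 :=
  ⟨Matrix.single i j 1, Matrix.trace_single_eq_of_ne _ _ _ h⟩

theorem tensI_unit {i j : Fin 3} (h : i ≠ j) (X : Mat) :
    tensI (unit h) X = Matrix.single i j 1 * X - X * Matrix.single i j 1 := rfl

variable {W : Submodule ℂ Mat}

/-- As `E_ij` squares to zero, applying `ad E_ij` twice leaves `-2 E_ij X E_ij`, which isolates the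
entry `X j i`. -/
theorem single_mem_of_apply_ne_zero (hW : ∀ x : sl3, ∀ X ∈ W, tensI x X ∈ W) {i j : Fin 3}
    (hij : i ≠ j) {X : Mat} (hX : X ∈ W) (h0 : X j i ≠ 0) :
    Matrix.single i j (1 : ℂ) ∈ W := by
  have hz : Matrix.single i j (1 : ℂ) * Matrix.single i j 1 = 0 :=
    Matrix.single_mul_single_of_ne _ _ _ _ hij.symm _
  have hs : Matrix.single i j (1 : ℂ) * (X * Matrix.single i j 1) =
      X j i • Matrix.single i j (1 : ℂ) := by
    rw [← mul_assoc, Matrix.single_mul_mul_single, Matrix.smul_single]; simp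
  have h1 : tensI (unit hij) (tensI (unit hij) X) =
      (-2 * X j i) • Matrix.single i j (1 : ℂ) := by
    simp only [tensI_unit, mul_sub, sub_mul, mul_assoc, hz, mul_zero, hs]
    rw [← mul_assoc, hz, zero_mul]
    module
  have h2 := hW (unit hij) _ (hW (unit hij) _ hX)
  rw [h1] at h2
  exact (W.smul_mem_iff (mul_ne_zero (by norm_num) h0)).1 h2

theorem single_mem_of_diagonal (hW : ∀ x : sl3, ∀ X ∈ W, tensI x X ∈ W) {i j : Fin 3}
    {d : Fin 3 → ℂ} (hd : Matrix.diagonal d ∈ W) (h : d i ≠ d j) :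
    Matrix.single i j (1 : ℂ) ∈ W := by
  have hij : i ≠ j := fun h' => h (h' ▸ rfl)
  have h1 : tensI (unit hij) (Matrix.diagonal d) = (d j - d i) • Matrix.single i j (1 : ℂ) := by
    rw [tensI_unit]
    ext k l
    rw [Matrix.sub_apply, Matrix.mul_diagonal, Matrix.diagonal_mul, Matrix.smul_apply,
      Matrix.single_apply]
    split_ifs with hkl
    · rw [← hkl.1, ← hkl.2, smul_eq_mul]; ring
    · simp
  have h2 := hW (unit hij) _ hd
  rw [h1] at h2
  exact (W.smul_mem_iff (sub_ne_zero.2 h.symm)).1 h2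

theorem exists_single_mem (hW : ∀ x : sl3, ∀ X ∈ W, tensI x X ∈ W) {X : Mat} (hX : X ∈ W)
    (hs : ∀ c : ℂ, X ≠ c • (1 : Mat)) :
    ∃ i j : Fin 3, i ≠ j ∧ Matrix.single i j (1 : ℂ) ∈ W := by
  by_cases hoff : ∃ i j : Fin 3, i ≠ j ∧ X j i ≠ 0
  · obtain ⟨i, j, hij, h0⟩ := hoff
    exact ⟨i, j, hij, single_mem_of_apply_ne_zero hW hij hX h0⟩
  · push Not at hoff
    have hdiag : Matrix.diagonal (fun i => X i i) = X := by
      ext i j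
      by_cases hij : i = j
      · subst hij; simp
      · rw [Matrix.diagonal_apply_ne _ hij, hoff j i (Ne.symm hij)]
    have hne : ∃ i j : Fin 3, X i i ≠ X j j := by
      by_contra! hall
      apply hs (X 0 0)
      rw [← hdiag, Matrix.smul_one_eq_diagonal]
      congr 1
      funext i
      simpa using hall i 0
    obtain ⟨i, j, hne⟩ := hne
    refine ⟨i, j, fun h => hne (h ▸ rfl), single_mem_of_diagonal hW (hdiag ▸ hX) hne⟩

theorem single_mem_of_single_mem (hW : ∀ x : sl3, ∀ X ∈ W, tensI x X ∈ W) {i j : Fin 3}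
    (hij : i ≠ j) (h : Matrix.single i j (1 : ℂ) ∈ W) {k l : Fin 3} (hkl : k ≠ l) :
    Matrix.single k l (1 : ℂ) ∈ W := by
  have row : ∀ {i j k : Fin 3}, i ≠ j → k ≠ j → Matrix.single i j (1 : ℂ) ∈ W →
      Matrix.single k j (1 : ℂ) ∈ W := by
    intro i j k _ hkj h
    by_cases hki : k = i
    · exact hki ▸ h
    have := hW (unit hki) _ h
    rwa [tensI_unit, Matrix.single_mul_single_same, Matrix.single_mul_single_of_ne _ _ _ _ hkj.symm,
      sub_zero, mul_one] at this
  have col : ∀ {i j l : Fin 3}, i ≠ j → i ≠ l → Matrix.single i j (1 : ℂ) ∈ W →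
      Matrix.single i l (1 : ℂ) ∈ W := by
    intro i j l _ hil h
    by_cases hjl : j = l
    · exact hjl ▸ h
    have := hW (unit hjl) _ h
    rw [tensI_unit, Matrix.single_mul_single_same, Matrix.single_mul_single_of_ne _ _ _ _ hil.symm,
      zero_sub, mul_one] at this
    exact neg_mem_iff.1 this
  by_cases hkj : k = j
  · by_cases hil : i = l
    -- The transposed position cannot be reached directly without crossing the diagonal; the route
    -- is `(i, j)`, `(m, j)`, `(m, i)`, `(j, i)`.
    · obtain ⟨m, hm1, hm2⟩ : ∃ m : Fin 3, m ≠ i ∧ m ≠ j :=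
        (by decide : ∀ i j : Fin 3, ∃ m : Fin 3, m ≠ i ∧ m ≠ j) i j
      have h1 := row hij hm2 h
      have h2 := col hm2 hm1 h1
      rw [← hil] at hkl ⊢
      exact row hm1 hkl h2
    · exact row hil hkl (col hij hil h)
  · exact col hkj hkl (row hij hkj h)

/-- One off-diagonal unit yields all of them, and `[E_kl, E_lk] = E_kk - E_ll` supplies the
traceless diagonal. -/
theorem coe_mem_of_not_scalar (hW : ∀ x : sl3, ∀ X ∈ W, tensI x X ∈ W) {X : Mat} (hX : X ∈ W)
    (hs : ∀ c : ℂ, X ≠ c • (1 : Mat)) {Y : Mat} (hY : Y.trace = 0) : Y ∈ W := by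
  obtain ⟨i, j, hij, h⟩ := exists_single_mem hW hX hs
  have off : ∀ {k l : Fin 3}, k ≠ l → Matrix.single k l (1 : ℂ) ∈ W :=
    fun hkl => single_mem_of_single_mem hW hij h hkl
  have diag : ∀ {k l : Fin 3}, k ≠ l →
      Matrix.single k k (1 : ℂ) - Matrix.single l l (1 : ℂ) ∈ W := by
    intro k l hkl
    have := hW (unit hkl) _ (off hkl.symm)
    rwa [tensI_unit, Matrix.single_mul_single_same, Matrix.single_mul_single_same, mul_one] at this
  have hdec : Y = Y 0 1 • Matrix.single 0 1 (1 : ℂ) + Y 0 2 • Matrix.single 0 2 (1 : ℂ)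
      + Y 1 0 • Matrix.single 1 0 (1 : ℂ) + Y 1 2 • Matrix.single 1 2 (1 : ℂ)
      + Y 2 0 • Matrix.single 2 0 (1 : ℂ) + Y 2 1 • Matrix.single 2 1 (1 : ℂ)
      + Y 0 0 • (Matrix.single 0 0 (1 : ℂ) - Matrix.single 2 2 (1 : ℂ))
      + Y 1 1 • (Matrix.single 1 1 (1 : ℂ) - Matrix.single 2 2 (1 : ℂ)) := by
    rw [Matrix.trace_fin_three] at hY
    ext k l
    fin_cases k <;> fin_cases l <;> simp
    linear_combination hY
  rw [hdec]
  refine W.add_mem (W.add_mem (W.add_mem (W.add_mem (W.add_mem (W.add_mem (W.add_mem ?_ ?_) ?_)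
    ?_) ?_) ?_) ?_) ?_
  all_goals first
    | exact W.smul_mem _ (off (by decide))
    | exact W.smul_mem _ (diag (by decide))

/-- The subspaces of matrices that are stable under `sl(3)`. -/
theorem adjoint_stable_classification (hW : ∀ x : sl3, ∀ X ∈ W, tensI x X ∈ W) :
    W = ⊥ ∨ W = ℂ ∙ (1 : Mat) ∨ W = LinearMap.ker (Matrix.traceLinearMap (Fin 3) ℂ ℂ) ∨ W = ⊤ := by
  have h1 : (1 : Mat).trace ≠ 0 := by simp [Matrix.trace_one]
  by_cases hs : ∀ X ∈ W, ∃ c : ℂ, X = c • (1 : Mat)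
  · by_cases hb : W = ⊥
    · exact Or.inl hb
    · refine Or.inr (Or.inl (le_antisymm (fun X hX => ?_) ?_))
      · obtain ⟨c, rfl⟩ := hs X hX
        exact Submodule.smul_mem _ _ (Submodule.mem_span_singleton_self _)
      · obtain ⟨X, hX, hX0⟩ := W.ne_bot_iff.1 hb
        obtain ⟨c, rfl⟩ := hs X hX
        have hc : c ≠ 0 := fun h => hX0 (by rw [h, zero_smul])
        rw [Submodule.span_singleton_le_iff_mem]
        exact (W.smul_mem_iff hc).1 hX
  · push Not at hs
    obtain ⟨X, hX, hs⟩ := hs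
    have hle : ∀ Y : Mat, Y.trace = 0 → Y ∈ W := fun Y hY => coe_mem_of_not_scalar hW hX hs hY
    by_cases ht : ∀ Y ∈ W, Y.trace = 0
    · exact Or.inr (Or.inr (Or.inl (le_antisymm (fun Y hY => ht Y hY) (fun Y hY => hle Y hY))))
    · push Not at ht
      obtain ⟨Z, hZ, hZ0⟩ := ht
      refine Or.inr (Or.inr (Or.inr (eq_top_iff.2 fun Y _ => ?_)))
      -- The traceless matrices have codimension one, so any `Z` of nonzero trace completes them.
      have h2 : Y - (Y.trace / Z.trace) • Z ∈ W := by
        apply hle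
        rw [trace_sub, trace_smul, smul_eq_mul, div_mul_cancel₀ _ hZ0, sub_self]
      have h3 := W.add_mem h2 (W.smul_mem (Y.trace / Z.trace) hZ)
      rwa [sub_add_cancel] at h3

end AdjointStable

/-! ### Stability under the operators `J(x)` -/

theorem tensJ_one (a b : ℂ) (x : sl3) : tensJ a b x 1 = (a - b - 3 / 2) • x.1 := by
  have hx : Matrix.trace x.1 = 0 := x.2
  rw [tensJ_apply, mul_one, one_mul, hx, trace_one, Fintype.card_fin]
  push_cast
  module

theorem trace_tensJ (a b : ℂ) (x : sl3) {X : Mat} (hX : X.trace = 0) :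
    (tensJ a b x X).trace = (a - b + 3 / 2) * (x.1 * X).trace := by
  rw [tensJ_apply]
  simp only [trace_add, trace_sub, trace_smul, hX, trace_one, Fintype.card_fin, smul_eq_mul,
    trace_mul_comm X x.1]
  push_cast
  ring

theorem trace_tensI (x : sl3) (X : Mat) : (tensI x X).trace = 0 := by
  rw [tensI_apply, trace_sub, trace_mul_comm, sub_self]

theorem tensI_one (x : sl3) : tensI x 1 = 0 := by rw [tensI_apply, mul_one, one_mul, sub_self]

theorem eq_of_tensJ_mem_span_one {a b : ℂ} (h : ∀ x : sl3, tensJ a b x 1 ∈ ℂ ∙ (1 : Mat)) :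
    a - b = 3 / 2 := by
  have h01 : (0 : Fin 3) ≠ 1 := by decide
  obtain ⟨c, hc⟩ := Submodule.mem_span_singleton.1 (h (unit h01))
  rw [tensJ_one] at hc
  have h1 := congrFun (congrFun hc 0) 1
  simp [unit] at h1
  linear_combination -h1

theorem eq_of_trace_tensJ_eq_zero {a b : ℂ}
    (h : ∀ (x : sl3) (X : Mat), X.trace = 0 → (tensJ a b x X).trace = 0) :
    a - b = -(3 / 2) := by
  have h01 : (0 : Fin 3) ≠ 1 := by decide
  -- The choice `x = E_01`, `X = E_10` makes `tr(xX) = 1`.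
  have h1 := h (unit h01) (unit h01.symm).1 (unit h01.symm).2
  rw [trace_tensJ a b _ (unit h01.symm).2] at h1
  simp [unit] at h1
  linear_combination h1

/-! ### Subrepresentations of the tensor product -/

section Generators

variable {M N : Type*} [AddCommGroup M] [Module ℂ M] [AddCommGroup N] [Module ℂ N]

theorem intertwines_of_generators {ρ : Yangian →ₐ[ℂ] Module.End ℂ M}
    {ρ' : Yangian →ₐ[ℂ] Module.End ℂ N} (L : M →ₗ[ℂ] N)
    (hI : ∀ x m, L (ρ (I x) m) = ρ' (I x) (L m)) (hJ : ∀ x m, L (ρ (J x) m) = ρ' (J x) (L m))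
    (y : Yangian) : ∀ m, L (ρ y m) = ρ' y (L m) := by
  obtain ⟨f, rfl⟩ : ∃ f, mk f = y := RingQuot.mkAlgHom_surjective ℂ Rel y
  induction f using FreeAlgebra.induction with
  | grade0 c =>
    intro m
    simp only [AlgHom.commutes, Module.algebraMap_end_apply, map_smul]
  | grade1 s =>
    cases s with
    | I x => exact hI x
    | J x => exact hJ x
  | mul f g hf hg =>
    intro m
    simp only [map_mul, Module.End.mul_apply, hf, hg]
  | add f g hf hg =>
    intro m
    simp only [map_add, LinearMap.add_apply, hf, hg]

theorem isSubrep_of_generators {ρ : Yangian →ₐ[ℂ] Module.End ℂ M} {U : Submodule ℂ M}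
    (hI : ∀ x, ∀ u ∈ U, ρ (I x) u ∈ U) (hJ : ∀ x, ∀ u ∈ U, ρ (J x) u ∈ U) : IsSubrep ρ U := by
  intro y
  obtain ⟨f, rfl⟩ : ∃ f, mk f = y := RingQuot.mkAlgHom_surjective ℂ Rel y
  induction f using FreeAlgebra.induction with
  | grade0 c =>
    intro u hu
    simpa only [AlgHom.commutes, Module.algebraMap_end_apply] using U.smul_mem c hu
  | grade1 s =>
    cases s with
    | I x => exact hI x
    | J x => exact hJ x
  | mul f g hf hg =>
    intro u hu
    rw [map_mul, map_mul]
    exact hf _ (hg _ hu)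
  | add f g hf hg =>
    intro u hu
    rw [map_add, map_add]
    exact U.add_mem (hf _ hu) (hg _ hu)

end Generators

/-- The invariant vector of `V ⊗ V*`. -/
def invariant : V ⊗[ℂ] VDual := toMat.symm 1

/-- The vectors of `V ⊗ V*` of trace zero. -/
def tracelessPart : Submodule ℂ (V ⊗[ℂ] VDual) :=
  (LinearMap.ker (Matrix.traceLinearMap (Fin 3) ℂ ℂ)).comap toMat.toLinearMap

theorem mem_tracelessPart {t : V ⊗[ℂ] VDual} : t ∈ tracelessPart ↔ (toMat t).trace = 0 := Iff.rfl

theorem toMat_invariant : toMat invariant = 1 := toMat.apply_symm_apply 1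

theorem invariant_ne_zero : invariant ≠ 0 := fun h => by
  have := toMat_invariant
  rw [h, map_zero] at this
  exact zero_ne_one this

theorem trace_one_ne_zero : (1 : Mat).trace ≠ 0 := by simp [trace_one]

theorem invariant_not_mem_tracelessPart : invariant ∉ tracelessPart := by
  rw [mem_tracelessPart, toMat_invariant]
  exact trace_one_ne_zero

theorem toMat_symm_coe_mem (z : sl3) : toMat.symm z.1 ∈ tracelessPart := by
  rw [mem_tracelessPart, LinearEquiv.apply_symm_apply]
  exact z.2

theorem exists_ne_zero_mem_tracelessPart : ∃ t ∈ tracelessPart, t ≠ 0 := by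
  have h01 : (0 : Fin 3) ≠ 1 := by decide
  refine ⟨toMat.symm (unit h01).1, toMat_symm_coe_mem _, fun h => ?_⟩
  have h1 := congrFun (congrFun ((map_eq_zero_iff _ toMat.symm.injective).1 h) 0) 1
  simp [unit] at h1

/-! ### Proper subrepresentations and their `sl(3)`-structure -/

section Classification

variable {a b : ℂ} {ρ : Yangian →ₐ[ℂ] Module.End ℂ (V ⊗[ℂ] VDual)}
  (hI : ∀ x t, toMat (ρ (I x) t) = tensI x (toMat t))
  (hJ : ∀ x t, toMat (ρ (J x) t) = tensJ a b x (toMat t))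

include hI hJ

theorem subrep_classification {U : Submodule ℂ (V ⊗[ℂ] VDual)} (hU : IsSubrep ρ U) :
    U = ⊥ ∨ (U = ℂ ∙ invariant ∧ a - b = 3 / 2) ∨ (U = tracelessPart ∧ a - b = -(3 / 2)) ∨
      U = ⊤ := by
  have hW : ∀ x : sl3, ∀ X ∈ U.comap toMat.symm.toLinearMap,
      tensI x X ∈ U.comap toMat.symm.toLinearMap := by
    intro x X hX
    have := hU (I x) _ hX
    rw [← toMat.symm_apply_apply (ρ (I x) (toMat.symm.toLinearMap X)), hI] at this
    simpa using this
  have hWJ : ∀ x : sl3, ∀ X ∈ U.comap toMat.symm.toLinearMap,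
      tensJ a b x X ∈ U.comap toMat.symm.toLinearMap := by
    intro x X hX
    have := hU (J x) _ hX
    rw [← toMat.symm_apply_apply (ρ (J x) (toMat.symm.toLinearMap X)), hJ] at this
    simpa using this
  have mem : ∀ t, t ∈ U ↔ toMat t ∈ U.comap toMat.symm.toLinearMap := fun t => by simp
  rcases adjoint_stable_classification hW with h | h | h | h <;> rw [h] at mem hWJ
  · left
    ext t
    rw [mem, Submodule.mem_bot, Submodule.mem_bot, map_eq_zero_iff _ toMat.injective]
  · right; left
    refine ⟨?_, eq_of_tensJ_mem_span_one fun x =>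
      hWJ x 1 (Submodule.mem_span_singleton_self _)⟩
    ext t
    rw [mem, Submodule.mem_span_singleton, Submodule.mem_span_singleton]
    refine exists_congr fun c => ?_
    rw [← toMat_invariant, ← map_smul, toMat.injective.eq_iff]
  · right; right; left
    refine ⟨?_, eq_of_trace_tensJ_eq_zero fun x X hX => hWJ x X hX⟩
    ext t
    rw [mem]
    rfl
  · right; right; right
    ext t
    rw [mem]
    simp

theorem isIrreducible_of_generic (h1 : a - b ≠ 3 / 2) (h2 : a - b ≠ -(3 / 2)) :
    IsIrreducible ρ := by
  refine ⟨⟨invariant, 0, invariant_ne_zero⟩, fun U hU => ?_⟩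
  rcases subrep_classification hI hJ hU with h | h | h | h
  · exact Or.inl h
  · exact absurd h.2 h1
  · exact absurd h.2 h2
  · exact Or.inr h

theorem apply_invariant (h : a - b = 3 / 2) (x : sl3) :
    ρ (I x) invariant = 0 ∧ ρ (J x) invariant = 0 := by
  constructor
  · apply toMat.injective
    rw [hI, toMat_invariant, tensI_one, map_zero]
  · apply toMat.injective
    rw [hJ, toMat_invariant, tensJ_one, h, sub_self, zero_smul, map_zero]

theorem isProperSubrep_span_invariant (h : a - b = 3 / 2) :
    IsProperSubrep ρ (ℂ ∙ invariant) := by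
  refine ⟨isSubrep_of_generators (fun x u hu => ?_) (fun x u hu => ?_), ?_, fun htop => ?_⟩
  · obtain ⟨c, rfl⟩ := Submodule.mem_span_singleton.1 hu
    rw [map_smul, (apply_invariant hI hJ h x).1, smul_zero]
    exact Submodule.zero_mem _
  · obtain ⟨c, rfl⟩ := Submodule.mem_span_singleton.1 hu
    rw [map_smul, (apply_invariant hI hJ h x).2, smul_zero]
    exact Submodule.zero_mem _
  · rw [Ne, Submodule.span_singleton_eq_bot]
    exact invariant_ne_zero
  · obtain ⟨t, ht, ht0⟩ := exists_ne_zero_mem_tracelessPart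
    obtain ⟨c, rfl⟩ := Submodule.mem_span_singleton.1 (htop ▸ Submodule.mem_top : t ∈ ℂ ∙ invariant)
    have hc : c ≠ 0 := fun hc => ht0 (by rw [hc, zero_smul])
    exact invariant_not_mem_tracelessPart ((tracelessPart.smul_mem_iff hc).1 ht)

theorem isProperSubrep_tracelessPart (h : a - b = -(3 / 2)) : IsProperSubrep ρ tracelessPart := by
  refine ⟨isSubrep_of_generators (fun x u hu => ?_) (fun x u hu => ?_), ?_, fun htop => ?_⟩
  · rw [mem_tracelessPart, hI, trace_tensI]
  · rw [mem_tracelessPart, hJ, trace_tensJ a b x (mem_tracelessPart.1 hu), h, neg_add_cancel, zero_mul]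
  · obtain ⟨t, ht, ht0⟩ := exists_ne_zero_mem_tracelessPart
    exact (Submodule.ne_bot_iff _).2 ⟨t, ht, ht0⟩
  · exact invariant_not_mem_tracelessPart (htop ▸ Submodule.mem_top)

theorem eq_span_invariant (h : a - b = 3 / 2) {U : Submodule ℂ (V ⊗[ℂ] VDual)}
    (hU : IsProperSubrep ρ U) : U = ℂ ∙ invariant := by
  rcases subrep_classification hI hJ hU.1 with h' | h' | h' | h'
  · exact absurd h' hU.2.1
  · exact h'.1
  · exact absurd (h.symm.trans h'.2) (by norm_num)
  · exact absurd h' hU.2.2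

theorem eq_tracelessPart (h : a - b = -(3 / 2)) {U : Submodule ℂ (V ⊗[ℂ] VDual)}
    (hU : IsProperSubrep ρ U) : U = tracelessPart := by
  rcases subrep_classification hI hJ hU.1 with h' | h' | h' | h'
  · exact absurd h' hU.2.1
  · exact absurd (h.symm.trans h'.2) (by norm_num)
  · exact h'.1
  · exact absurd h' hU.2.2

theorem existsUnique_properSubrep (h : a - b = 3 / 2 ∨ a - b = -(3 / 2)) :
    ∃! U, IsProperSubrep ρ U := by
  rcases h with h | h
  · exact ⟨_, isProperSubrep_span_invariant hI hJ h, fun U hU => eq_span_invariant hI hJ h hU⟩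
  · exact ⟨_, isProperSubrep_tracelessPart hI hJ h, fun U hU => eq_tracelessPart hI hJ h hU⟩

theorem span_invariant_equiv_trivial (h : a - b = 3 / 2) :
    ∃ ρ₀ : Yangian →ₐ[ℂ] Module.End ℂ ℂ, IsEvaluation 0 0 ρ₀ ∧
      ∃ f : ℂ ≃ₗ[ℂ] (ℂ ∙ invariant), ∀ y c,
        (f (ρ₀ y c) : V ⊗[ℂ] VDual) = ρ y (f c) := by
  obtain ⟨ρ₀, h₀⟩ := exists_trivial
  refine ⟨ρ₀, h₀, LinearEquiv.toSpanNonzeroSingleton ℂ _ invariant invariant_ne_zero,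
    intertwines_of_generators (LinearMap.toSpanSingleton ℂ _ invariant) (fun x c => ?_)
      (fun x c => ?_)⟩
  · rw [(h₀ x).1, LinearMap.toSpanSingleton_apply, LinearMap.toSpanSingleton_apply, map_smul,
      (apply_invariant hI hJ h x).1]
    simp
  · rw [(h₀ x).2, LinearMap.toSpanSingleton_apply, LinearMap.toSpanSingleton_apply, map_smul,
      (apply_invariant hI hJ h x).2]
    simp

omit hJ

/-- Taking the traceless part is `sl(3)`-equivariant and surjective, with the scalars as kernel. -/
theorem quotient_equiv_adjoint :
    ∃ f : (V ⊗[ℂ] VDual ⧸ (ℂ ∙ invariant)) ≃ₗ[ℂ] sl3,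
      ∀ x w, f ((ℂ ∙ invariant).mkQ (ρ (I x) w)) = ⁅x, f ((ℂ ∙ invariant).mkQ w)⁆ := by
  let p : V ⊗[ℂ] VDual →ₗ[ℂ] sl3 :=
    { toFun := fun t => traceless (toMat t)
      map_add' := fun s t => Subtype.ext (by
        change toMat (s + t) - _ = (toMat s - _) + (toMat t - _)
        rw [map_add, trace_add]; module)
      map_smul' := fun c t => Subtype.ext (by
        change toMat (c • t) - _ = c • (toMat t - _)
        rw [map_smul, trace_smul, smul_eq_mul]; module) }
  have hp : Function.Surjective p := fun z => ⟨toMat.symm z.1, Subtype.ext (by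
    change toMat (toMat.symm z.1) - ((toMat (toMat.symm z.1)).trace / 3) • (1 : Mat) = z.1
    have hz : Matrix.trace z.1 = 0 := z.2
    rw [LinearEquiv.apply_symm_apply, hz, zero_div, zero_smul, sub_zero])⟩
  have hker : (ℂ ∙ invariant) = LinearMap.ker p := by
    ext t
    rw [Submodule.mem_span_singleton, LinearMap.mem_ker]
    constructor
    · rintro ⟨c, rfl⟩
      rw [map_smul]
      refine (congrArg (c • ·) (Subtype.ext ?_ : p invariant = 0)).trans (smul_zero c)
      change toMat invariant - ((toMat invariant).trace / 3) • (1 : Mat) = 0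
      rw [toMat_invariant, trace_one]
      simp
    · intro ht
      refine ⟨(toMat t).trace / 3, toMat.injective ?_⟩
      have h1 : toMat t - ((toMat t).trace / 3) • (1 : Mat) = 0 := congrArg Subtype.val ht
      rw [map_smul, toMat_invariant]
      exact (sub_eq_zero.1 h1).symm
  refine ⟨(Submodule.quotEquivOfEq _ _ hker).trans (p.quotKerEquivOfSurjective hp), fun x w => ?_⟩
  change p (ρ (I x) w) = ⁅x, p w⁆
  apply Subtype.ext
  change toMat (ρ (I x) w) - ((toMat (ρ (I x) w)).trace / 3) • (1 : Mat) =
    x.1 * (toMat w - ((toMat w).trace / 3) • (1 : Mat)) -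
      (toMat w - ((toMat w).trace / 3) • (1 : Mat)) * x.1
  rw [hI, trace_tensI, tensI_apply]
  simp only [mul_sub, sub_mul, mul_smul_comm, smul_mul_assoc, mul_one, one_mul]
  module

theorem adjoint_equiv_tracelessPart :
    ∃ f : sl3 ≃ₗ[ℂ] tracelessPart, ∀ x z, (f ⁅x, z⁆ : V ⊗[ℂ] VDual) = ρ (I x) (f z) := by
  let f : sl3 ≃ₗ[ℂ] tracelessPart :=
    { toFun := fun z => ⟨toMat.symm z.1, toMat_symm_coe_mem z⟩
      map_add' := fun y z => Subtype.ext (map_add toMat.symm y.1 z.1)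
      map_smul' := fun c z => Subtype.ext (map_smul toMat.symm c z.1)
      invFun := fun t => ⟨toMat t.1, t.2⟩
      left_inv := fun z => Subtype.ext (toMat.apply_symm_apply z.1)
      right_inv := fun t => Subtype.ext (toMat.symm_apply_apply t.1) }
  refine ⟨f, fun x z => toMat.injective ?_⟩
  rw [hI]
  change toMat (toMat.symm (x.1 * z.1 - z.1 * x.1)) = tensI x (toMat (toMat.symm z.1))
  rw [LinearEquiv.apply_symm_apply, LinearEquiv.apply_symm_apply, tensI_apply]

end Classification

end YangianSL3

end

theorem corollary5p2 (a b : ℂ) :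
    ∃ (ρ₁ : YangianSL3.Yangian →ₐ[ℂ] Module.End ℂ YangianSL3.V)
      (ρ₂ : YangianSL3.Yangian →ₐ[ℂ] Module.End ℂ YangianSL3.VDual)
      (ρ : YangianSL3.Yangian →ₐ[ℂ]
        Module.End ℂ (TensorProduct ℂ YangianSL3.V YangianSL3.VDual)),
      YangianSL3.IsEvaluation YangianSL3.vecAction a ρ₁ ∧
      YangianSL3.IsEvaluation YangianSL3.dualAction b ρ₂ ∧
      YangianSL3.IsTensorProduct ρ₁ ρ₂ ρ ∧
      -- the irreducible case
      (a - b ≠ 3 / 2 → a - b ≠ -(3 / 2) → YangianSL3.IsIrreducible ρ) ∧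
      -- otherwise there is a unique proper subrepresentation
      (a - b = 3 / 2 ∨ a - b = -(3 / 2) → ∃! U, YangianSL3.IsProperSubrep ρ U) ∧
      -- first exceptional case
      (a - b = 3 / 2 → ∀ U, YangianSL3.IsProperSubrep ρ U →
        -- as a representation of the Yangian, `U` is `V(0, 0)`
        (∃ ρ₀ : YangianSL3.Yangian →ₐ[ℂ] Module.End ℂ ℂ, YangianSL3.IsEvaluation 0 0 ρ₀ ∧
          ∃ f : ℂ ≃ₗ[ℂ] U, ∀ y c,
            (f (ρ₀ y c) : TensorProduct ℂ YangianSL3.V YangianSL3.VDual) = ρ y (f c)) ∧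
        -- the quotient is the adjoint representation of `sl(3)`
        ∃ f : (TensorProduct ℂ YangianSL3.V YangianSL3.VDual ⧸ U) ≃ₗ[ℂ] YangianSL3.sl3,
          ∀ x w, f (U.mkQ (ρ (YangianSL3.I x) w)) = ⁅x, f (U.mkQ w)⁆) ∧
      -- second exceptional case
      (a - b = -(3 / 2) → ∀ U, YangianSL3.IsProperSubrep ρ U →
        -- `U` is the adjoint representation of `sl(3)`
        ∃ f : YangianSL3.sl3 ≃ₗ[ℂ] U, ∀ x z,
          (f ⁅x, z⁆ : TensorProduct ℂ YangianSL3.V YangianSL3.VDual) =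
            ρ (YangianSL3.I x) (f z)) := by
  obtain ⟨ρ₁, h₁⟩ := YangianSL3.exists_vec a
  obtain ⟨ρ₂, h₂⟩ := YangianSL3.exists_dual b
  obtain ⟨ρ, hρ, h⟩ := YangianSL3.exists_tensorProduct h₁ h₂
  have hI := fun x t => (h x t).1
  have hJ := fun x t => (h x t).2
  refine ⟨ρ₁, ρ₂, ρ, h₁, h₂, hρ, YangianSL3.isIrreducible_of_generic hI hJ,
    YangianSL3.existsUnique_properSubrep hI hJ, fun hab U hU => ?_, fun hab U hU => ?_⟩
  · obtain rfl := YangianSL3.eq_span_invariant hI hJ hab hU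
    exact ⟨YangianSL3.span_invariant_equiv_trivial hI hJ hab,
      YangianSL3.quotient_equiv_adjoint hI⟩
  · obtain rfl := YangianSL3.eq_tracelessPart hI hJ hab hU
    exact YangianSL3.adjoint_equiv_tracelessPart hI
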